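/- Let $k$ be a field of characteristic $0$, let $\Gamma$ be an abelian group and let $\epsilon:\Gamma\times\Gamma\to k^{*}$ be a commutation factor: $\epsilon(\alpha,\beta)\epsilon(\beta,\alpha)=1$, $\epsilon(\alpha,\beta+\gamma)=\epsilon(\alpha,\beta)\epsilon(\alpha,\gamma)$, $\epsilon(\alpha+\beta,\gamma)=\epsilon(\alpha,\gamma)\epsilon(\beta,\gamma)$. All vector spaces are over $k$, and formulas stated for homogeneous elements are extended linearly. **Algebras and modules.** A *generalized left-symmetric algebra* is a finite-dimensional $\Gamma$-graded space $S=\bigoplus_{\gamma}S_\gamma$ with a bilinear product satisfying $S_\alpha\cdot S_\beta\subseteq S_{\alpha+\beta}$ and $$(x\cdot y)\cdot z-x\cdot(y\cdot z)=\epsilon(\alpha,\beta)\bigl((y\cdot x)\cdot z-y\cdot(x\cdot z)\bigr),\qquad x\in S_\alpha,\ y\in S_\beta,\ z\in S .$$ An *$S$-bimodule* is a finite-dimensional $\Gamma$-graded space $M$ with bilinear actions $S\times M\to M$ and $M\times S\to M$ satisfying $S_\alpha\cdot M_\beta\subseteq M_{\alpha+\beta}$, $M_\alpha\cdot S_\beta\subseteq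 M_{\alpha+\beta}$ and, for $x\in S_\alpha$, $y\in S_\beta$, $m\in M_\gamma$, $$(x\cdot y)\cdot m-x\cdot(y\cdot m)=\epsilon(\alpha,\beta)\bigl((y\cdot x)\cdot m-y\cdot(x\cdot m)\bigr),$$ $$(x\cdot m)\cdot y-x\cdot(m\cdot y)=\epsilon(\alpha,\gamma)\bigl((m\cdot x)\cdot y-m\cdot(x\cdot y)\bigr).$$ The bracket $[x,y]=x\cdot y-\epsilon(\alpha,\beta)\,y\cdot x$ ($x\in S_\alpha$, $y\in S_\beta$) makes $S$ an $\epsilon$-Lie algebra $\mathfrak g_S$. A (left) $\mathfrak g_S$-module is a $\Gamma$-graded space $W$ with a bilinear action $(x,w)\mapsto[x,w]$ such that $[S_\alpha,W_\beta]\subseteq W_{\alpha+\beta}$ and $[[x,y],w]=[x,[y,w]]-\epsilon(\alpha,\beta)[y,[x,w]]$ for $x\in S_\alpha$, $y\in S_\beta$. **Cochains.** For $\beta\in\Gamma$, a multilinear map $f$ on $S^{n}$ has degree $\beta$ if $f(x_1,\dots,x_n)$ has degree $\beta+\alpha_1+\dots+\alpha_n$ whenever $x_s\in S_{\alpha_s}$;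 it is $\epsilon$-skew in two adjacent arguments if exchanging $x_s\in S_{\alpha_s}$ and $x_{s+1}\in S_{\alpha_{s+1}}$ gives $f(\dots,x_s,x_{s+1},\dots)=-\epsilon(\alpha_s,\alpha_{s+1})f(\dots,x_{s+1},x_s,\dots)$. For $i\ge 0$ let $$C^{i+1}(S,M)=\bigoplus_{\beta}\operatorname{Hom}_\beta(\wedge_\epsilon^{i}S\otimes S,M),$$ where $\operatorname{Hom}_\beta(\wedge_\epsilon^{i}S\otimes S,M)$ consists of the multilinear maps $S^{i+1}\to M$ of degree $\beta$ that are $\epsilon$-skew in the first $i$ arguments. In particular $C^1(S,M)=\operatorname{Hom}(S,M)$, graded by degree; it is a $\mathfrak g_S$-module via $$[x,f](y)=x\cdot f(y)-\epsilon(\alpha,\beta)f(x\cdot y)+\epsilon(\alpha,\beta)f(x)\cdot y,\qquad x\in S_\alpha,\ f\in C^1(S,M)_\beta .$$ For a $\mathfrak g_S$-module $W$ and $i\ge0$ let $$C^{i}(\mathfrak g_S,W)=\bigoplus_\beta\operatorname{Hom}_\beta(\wedge_\epsilon^{i}\mathfrak g_S,W),$$ where $\operatorname{Hom}_\beta(\wedge_\epsilon^{i}\mathfrak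 g_S,W)$ consists of the multilinear maps $S^i\to W$ of degree $\beta$ that are $\epsilon$-skew in all their arguments. **Actions of $\mathfrak g_S$.** For $x\in S_\alpha$, $f$ of degree $\beta$ and $x_s\in S_{\alpha_s}$, let, on $C^i(\mathfrak g_S,W)$, $$(\xi(x)f)(x_1,\dots,x_i)=[x,f(x_1,\dots,x_i)]-\sum_{j=1}^{i}\epsilon(\alpha,\beta+\alpha_1+\dots+\alpha_{j-1})f(x_1,\dots,[x,x_j],\dots,x_i),$$ and, on $C^{i+1}(S,M)$, with $e=\epsilon(\alpha,\beta+\alpha_1+\dots+\alpha_i)$, $$\begin{aligned}(\rho(x)f)(x_1,\dots,x_{i+1})={}&x\cdot f(x_1,\dots,x_{i+1})-e\,f(x_1,\dots,x_i,x\cdot x_{i+1})+e\,f(x_1,\dots,x_i,x)\cdot x_{i+1}\\&-\sum_{j=1}^{i}\epsilon(\alpha,\beta+\alpha_1+\dots+\alpha_{j-1})f(x_1,\dots,[x,x_j],\dots,x_i,x_{i+1}).\end{aligned}$$ **Coboundaries and cohomology.** For $f$ of degree $\beta$ and $x_s\in S_{\alpha_s}$, put $\epsilon_t=\epsilon(\beta+\alpha_1+\dots+\alpha_{t-1},\alpha_t)$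 and $\epsilon_{t,j}=\epsilon(\alpha_t,\alpha_{t+1}+\dots+\alpha_{j-1})$. Define $\mathfrak d:C^{i}(\mathfrak g_S,W)\to C^{i+1}(\mathfrak g_S,W)$, $i\ge 0$, by $$\begin{aligned}(\mathfrak d f)(x_1,\dots,x_{i+1})=\sum_{t=1}^{i+1}(-1)^{t+1}\Bigl(&\epsilon_t\,[x_t,f(x_1,\dots,\hat x_t,\dots,x_{i+1})]\\&-\sum_{t<j\le i+1}\epsilon_{t,j}\,f(x_1,\dots,\hat x_t,\dots,x_{j-1},[x_t,x_j],x_{j+1},\dots,x_{i+1})\Bigr),\end{aligned}$$ and $d:C^{i}(S,M)\to C^{i+1}(S,M)$, $i\ge1$, by $$\begin{aligned}(df)(x_1,\dots,x_{i+1})=\sum_{t=1}^{i}(-1)^{t+1}\Bigl(&\epsilon_t\,x_t\cdot f(x_1,\dots,\hat x_t,\dots,x_{i+1})-\epsilon_{t,i+1}\,f(x_1,\dots,\hat x_t,\dots,x_i,x_t\cdot x_{i+1})\\&+\epsilon_{t,i+1}\,f(x_1,\dots,\hat x_t,\dots,x_i,x_t)\cdot x_{i+1}\\&-\sum_{t<j\le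 i}\epsilon_{t,j}\,f(x_1,\dots,\hat x_t,\dots,x_{j-1},[x_t,x_j],x_{j+1},\dots,x_i,x_{i+1})\Bigr).\end{aligned}$$ Let $H^{i}_{\mathrm{Lie}}(\mathfrak g_S,W)$ be the space of $i$-cocycles (the kernel of $\mathfrak d$ on $C^i(\mathfrak g_S,W)$) modulo the $i$-coboundaries (the image of $\mathfrak d$ from $C^{i-1}(\mathfrak g_S,W)$), and for $i\ge 2$ let $H^i(S,M)$ be the kernel of $d$ on $C^i(S,M)$ modulo the image of $d$ from $C^{i-1}(S,M)$. **Theorem 4.1.** Let $S$ be a generalized left-symmetric algebra and $M$ an $S$-bimodule. For $i\ge0$ let $$\psi:C^{i}(\mathfrak g_S,C^{1}(S,M))\to C^{i+1}(S,M),\qquad \psi(f)(x_1,\dots,x_i,x_{i+1})=f(x_1,\dots,x_i)(x_{i+1}).$$ 1. For every $i\ge 0$, $\xi$ and $\rho$ make $C^{i}(\mathfrak g_S,C^1(S,M))$ and $C^{i+1}(S,M)$ into $\mathfrak g_S$-modules, and $\psi$ is an isomorphism of $\mathfrak g_S$-modules: it is linear and bijective, maps the component of each degree $\gamma\in\Gamma$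 onto the component of degree $\gamma$, and satisfies $\psi(\xi(x)f)=\rho(x)\psi(f)$ for all $x\in\mathfrak g_S$ and all $f$. 2. $\mathfrak d^2=0$ on $\bigoplus_{i\ge0}C^{i}(\mathfrak g_S,C^1(S,M))$, $d^2=0$ on $\bigoplus_{i\ge1}C^i(S,M)$, and $\psi\,\mathfrak d=d\,\psi$ on $C^{i}(\mathfrak g_S,C^1(S,M))$ for every $i\ge0$. Thus $\psi$ is an isomorphism of cochain complexes from $\bigoplus_{i\ge0}C^{i}(\mathfrak g_S,C^{1}(S,M))$ to $\bigoplus_{i\ge1}C^{i}(S,M)$. 3. Consequently, for every $i>0$, $\psi$ maps $i$-cocycles to $(i+1)$-cocycles and induces a linear isomorphism $$H^{i}_{\mathrm{Lie}}(\mathfrak g_S,C^{1}(S,M))\;\cong\;H^{i+1}(S,M).$$ -/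

import Mathlib

open scoped DirectSum

namespace GLSA

/-- A commutation factor on the abelian group `Γ` with values in `kˣ`. -/
structure CommutationFactor (Γ k : Type*) [AddCommGroup Γ] [Field k] where
  toFun : Γ → Γ → kˣ
  mul_swap' : ∀ α β, toFun α β * toFun β α = 1
  add_right' : ∀ α β γ, toFun α (β + γ) = toFun α β * toFun α γ
  add_left' : ∀ α β γ, toFun (α + β) γ = toFun α γ * toFun β γ

section Basic

variable {Γ k : Type*} [AddCommGroup Γ] [Field k]

/-- The value of a commutation factor, as a scalar of `k`. -/
def CommutationFactor.val (ε : CommutationFactor Γ k) (α β : Γ) : k := (ε.toFun α β : k)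

/-- `ε α β` is read as a scalar of `k`. -/
instance : CoeFun (CommutationFactor Γ k) (fun _ => Γ → Γ → k) := ⟨CommutationFactor.val⟩

namespace CommutationFactor

variable (ε : CommutationFactor Γ k)

theorem mul_swap (α β : Γ) : ε α β * ε β α = 1 := by
  simpa [val] using congrArg Units.val (ε.mul_swap' α β)

theorem add_right (α β γ : Γ) : ε α (β + γ) = ε α β * ε α γ := by
  simp [val, ε.add_right']

theorem add_left (α β γ : Γ) : ε (α + β) γ = ε α γ * ε β γ := by
  simp [val, ε.add_left']

theorem zero_right (α : Γ) : ε α 0 = 1 := by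
  have h := ε.add_right' α 0 0
  rw [add_zero] at h
  have h' : ε.toFun α 0 = 1 := by simpa using h
  simp [val, h']

end CommutationFactor

end Basic

section Lift

variable {Γ k : Type*} [DecidableEq Γ] [Field k]
variable {V U : Type*} [AddCommGroup V] [Module k V] [AddCommGroup U] [Module k U]
variable (𝒱 : Γ → Submodule k V) [DirectSum.Decomposition 𝒱]

/-- The linear map on a graded space that is `F α` on the component of degree `α`. -/
noncomputable def gradedLift (F : Γ → V →ₗ[k] U) : V →ₗ[k] U :=
  DirectSum.toModule k Γ U (fun α => (F α).comp (𝒱 α).subtype) ∘ₗ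
    (DirectSum.decomposeLinearEquiv 𝒱).toLinearMap

theorem gradedLift_apply (F : Γ → V →ₗ[k] U) {α : Γ} {v : V} (hv : v ∈ 𝒱 α) :
    gradedLift 𝒱 F v = F α v := by
  lift v to 𝒱 α using hv
  simp [gradedLift]

theorem linearMap_ext_of_homogeneous {f g : V →ₗ[k] U}
    (h : ∀ α, ∀ v ∈ 𝒱 α, f v = g v) : f = g := by
  apply DirectSum.decompose_lhom_ext 𝒱
  intro α
  ext v
  exact h α v v.2

/-- The multilinear map on a graded space that is `F α` on tuples whose `s`-th entry is
homogeneous of degree `α s`. -/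
noncomputable def gradedMultiLift {n : ℕ}
    (F : (Fin n → Γ) → MultilinearMap k (fun _ : Fin n => V) U) :
    MultilinearMap k (fun _ : Fin n => V) U :=
  (MultilinearMap.fromDirectSumEquiv (R := k) (ι := Fin n) (κ := fun _ => Γ)
    (M := fun _ α => 𝒱 α)
    (fun α => (F α).compLinearMap (fun s => (𝒱 (α s)).subtype))).compLinearMap
    (fun _ => (DirectSum.decomposeLinearEquiv 𝒱).toLinearMap)

theorem gradedMultiLift_apply {n : ℕ}
    (F : (Fin n → Γ) → MultilinearMap k (fun _ : Fin n => V) U)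
    {α : Fin n → Γ} {x : Fin n → V} (hx : ∀ s, x s ∈ 𝒱 (α s)) :
    gradedMultiLift 𝒱 F x = F α x := by
  have h := MultilinearMap.fromDirectSumEquiv_lof (R := k) (ι := Fin n) (κ := fun _ => Γ)
    (M := fun _ α => 𝒱 α)
    (fun α => (F α).compLinearMap (fun s => (𝒱 (α s)).subtype)) α (fun s => ⟨x s, hx s⟩)
  have e : (fun s => DirectSum.decomposeLinearEquiv 𝒱 (x s)) =
      fun s => DirectSum.lof k Γ (fun i => 𝒱 i) (α s) ⟨x s, hx s⟩ := by
    funext s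
    rw [DirectSum.decomposeLinearEquiv_apply, DirectSum.decompose_of_mem 𝒱 (hx s)]
    rfl
  simp only [gradedMultiLift, MultilinearMap.compLinearMap_apply, LinearEquiv.coe_coe]
  rw [e, h]
  simp

theorem multilinearMap_ext_of_homogeneous {n : ℕ}
    {f g : MultilinearMap k (fun _ : Fin n => V) U}
    (h : ∀ (α : Fin n → Γ) (x : Fin n → V), (∀ s, x s ∈ 𝒱 (α s)) → f x = g x) : f = g := by
  have key : ∀ f : MultilinearMap k (fun _ : Fin n => V) U, f = ((f.compLinearMap
      (fun _ => (DirectSum.decomposeLinearEquiv 𝒱).symm.toLinearMap)).compLinearMap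
      (fun _ => (DirectSum.decomposeLinearEquiv 𝒱).toLinearMap)) := by
    intro f; ext x; simp
  rw [key f, key g]
  congr 1
  apply MultilinearMap.dfinsupp_ext (κ := fun _ : Fin n => Γ) (M := fun _ α => 𝒱 α)
  intro α
  ext x
  have e : ∀ s, (DirectSum.decomposeLinearEquiv 𝒱).symm
      (DFinsupp.lsingle (R := k) (M := fun i => 𝒱 i) (α s) (x s)) = (x s : V) := fun s =>
    DirectSum.decomposeLinearEquiv_symm_lof 𝒱 (α s) (x s)
  have := h α (fun s => x s) (fun s => (x s).2)
  simp only [MultilinearMap.compLinearMap_apply, LinearEquiv.coe_coe]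
  erw [funext e]
  exact this

end Lift

section Algebra

variable {Γ k : Type*} [AddCommGroup Γ] [Field k] (ε : CommutationFactor Γ k)
variable {S M : Type*} [AddCommGroup S] [Module k S] [AddCommGroup M] [Module k M]

/-- A generalized left-symmetric algebra structure on the graded space `S = ⨁ 𝒮 γ`. -/
structure LeftSymmetricAlgebra (𝒮 : Γ → Submodule k S) where
  mul : S →ₗ[k] S →ₗ[k] S
  mul_mem : ∀ {α β : Γ} {x y : S}, x ∈ 𝒮 α → y ∈ 𝒮 β → mul x y ∈ 𝒮 (α + β)
  left_symm : ∀ {α β : Γ} {x y : S}, x ∈ 𝒮 α → y ∈ 𝒮 β → ∀ z : S,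
    mul (mul x y) z - mul x (mul y z) = ε α β • (mul (mul y x) z - mul y (mul x z))

/-- An `ε`-Lie algebra structure on the graded space `L = ⨁ ℒ γ`. -/
structure EpsLieAlgebra (ℒ : Γ → Submodule k S) where
  bracket : S →ₗ[k] S →ₗ[k] S
  bracket_mem : ∀ {α β : Γ} {x y : S}, x ∈ ℒ α → y ∈ ℒ β → bracket x y ∈ ℒ (α + β)
  skew : ∀ {α β : Γ} {x y : S}, x ∈ ℒ α → y ∈ ℒ β →
    bracket x y + ε α β • bracket y x = 0
  jacobi : ∀ {α β γ : Γ} {x y z : S}, x ∈ ℒ α → y ∈ ℒ β → z ∈ ℒ γ →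
    ε γ α • bracket x (bracket y z) + ε α β • bracket y (bracket z x) +
      ε β γ • bracket z (bracket x y) = 0

variable {ε}

/-- `act` makes the graded space `W = ⨁ 𝒲 γ` a left module over the `ε`-Lie algebra `𝔤`. -/
structure EpsLieAlgebra.IsModule {ℒ : Γ → Submodule k S} (𝔤 : EpsLieAlgebra ε ℒ)
    (𝒲 : Γ → Submodule k M) (act : S →ₗ[k] M →ₗ[k] M) : Prop where
  act_mem : ∀ {α β : Γ} {x : S} {m : M}, x ∈ ℒ α → m ∈ 𝒲 β → act x m ∈ 𝒲 (α + β)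
  act_bracket : ∀ {α β : Γ} {x y : S}, x ∈ ℒ α → y ∈ ℒ β → ∀ m : M,
    act (𝔤.bracket x y) m = act x (act y m) - ε α β • act y (act x m)

/-- A left module over the `ε`-Lie algebra `𝔤` on the graded space `W = ⨁ 𝒲 γ`. -/
structure EpsLieModule {ℒ : Γ → Submodule k S} (𝔤 : EpsLieAlgebra ε ℒ)
    (𝒲 : Γ → Submodule k M) where
  act : S →ₗ[k] M →ₗ[k] M
  isModule : 𝔤.IsModule 𝒲 act

/-- A bimodule over a generalized left-symmetric algebra, on the graded space `M = ⨁ ℳ γ`. -/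
structure Bimodule {𝒮 : Γ → Submodule k S} (A : LeftSymmetricAlgebra ε 𝒮)
    (ℳ : Γ → Submodule k M) where
  left : S →ₗ[k] M →ₗ[k] M
  right : M →ₗ[k] S →ₗ[k] M
  left_mem : ∀ {α β : Γ} {x : S} {m : M}, x ∈ 𝒮 α → m ∈ ℳ β → left x m ∈ ℳ (α + β)
  right_mem : ∀ {α β : Γ} {m : M} {x : S}, m ∈ ℳ α → x ∈ 𝒮 β → right m x ∈ ℳ (α + β)
  left_left : ∀ {α β : Γ} {x y : S}, x ∈ 𝒮 α → y ∈ 𝒮 β → ∀ m : M,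
    left (A.mul x y) m - left x (left y m) =
      ε α β • (left (A.mul y x) m - left y (left x m))
  left_right : ∀ {α γ : Γ} {x : S} {m : M}, x ∈ 𝒮 α → m ∈ ℳ γ → ∀ y : S,
    right (left x m) y - left x (right m y) =
      ε α γ • (right (right m x) y - right m (A.mul x y))

variable [DecidableEq Γ]

namespace LeftSymmetricAlgebra

variable {𝒮 : Γ → Submodule k S} [DirectSum.Decomposition 𝒮] (A : LeftSymmetricAlgebra ε 𝒮)

/-- The `ε`-commutator: `[x, y] = x · y - ε(α, β) y · x` for `x ∈ S_α`, `y ∈ S_β`, extended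
bilinearly. -/
noncomputable def commutator : S →ₗ[k] S →ₗ[k] S :=
  gradedLift 𝒮 fun α =>
    (gradedLift 𝒮 fun β => (A.mul - ε α β • A.mul.flip).flip).flip

theorem commutator_apply {α β : Γ} {x y : S} (hx : x ∈ 𝒮 α) (hy : y ∈ 𝒮 β) :
    A.commutator x y = A.mul x y - ε α β • A.mul y x := by
  rw [commutator, gradedLift_apply 𝒮 _ hx, LinearMap.flip_apply, gradedLift_apply 𝒮 _ hy]
  simp

theorem commutator_mem {α β : Γ} {x y : S} (hx : x ∈ 𝒮 α) (hy : y ∈ 𝒮 β) :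
    A.commutator x y ∈ 𝒮 (α + β) := by
  rw [A.commutator_apply hx hy]
  exact Submodule.sub_mem _ (A.mul_mem hx hy)
    (Submodule.smul_mem _ _ (add_comm β α ▸ A.mul_mem hy hx))

/-- The associated `ε`-Lie algebra `𝔤_S`. -/
noncomputable def lie : EpsLieAlgebra ε 𝒮 where
  bracket := A.commutator
  bracket_mem := A.commutator_mem
  skew {α β x y} hx hy := by
    rw [A.commutator_apply hx hy, A.commutator_apply hy hx, smul_sub, smul_smul, ε.mul_swap]
    module
  jacobi {α β γ x y z} hx hy hz := by
    rw [A.commutator_apply hx (A.commutator_mem hy hz),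
      A.commutator_apply hy (A.commutator_mem hz hx),
      A.commutator_apply hz (A.commutator_mem hx hy),
      A.commutator_apply hx hy, A.commutator_apply hy hz, A.commutator_apply hz hx]
    have h1 := A.left_symm hx hy z
    have h2 := A.left_symm hy hz x
    have h3 := A.left_symm hz hx y
    have e1 := ε.mul_swap α β
    have e2 := ε.mul_swap β γ
    have e3 := ε.mul_swap γ α
    simp only [ε.add_right, map_sub, map_smul, LinearMap.sub_apply, LinearMap.smul_apply]
    rw [sub_eq_iff_eq_add] at h1 h2 h3
    rw [h1, h2, h3]
    match_scalars <;> grind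

end LeftSymmetricAlgebra

end Algebra

section HomSpace

variable {Γ k : Type*} [AddCommGroup Γ] [DecidableEq Γ] [Field k]
variable {S M : Type*} [AddCommGroup S] [Module k S] [AddCommGroup M] [Module k M]

/-- `Hom_γ(S, M)`: the linear maps that are homogeneous of degree `γ`. -/
def homDeg (𝒮 : Γ → Submodule k S) (ℳ : Γ → Submodule k M) (γ : Γ) :
    Submodule k (S →ₗ[k] M) where
  carrier := {f | ∀ α, ∀ x ∈ 𝒮 α, f x ∈ ℳ (γ + α)}
  add_mem' hf hg α x hx := Submodule.add_mem _ (hf α x hx) (hg α x hx)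
  zero_mem' _ _ _ := Submodule.zero_mem _
  smul_mem' c _ hf α x hx := Submodule.smul_mem _ c (hf α x hx)

variable (𝒮 : Γ → Submodule k S) [DirectSum.Decomposition 𝒮]
variable (ℳ : Γ → Submodule k M) [DirectSum.Decomposition ℳ]

/-- The component of degree `γ` of a linear map. -/
noncomputable def homProj (γ : Γ) : (S →ₗ[k] M) →ₗ[k] homDeg 𝒮 ℳ γ where
  toFun f := ⟨gradedLift 𝒮 fun α => gradedLift ℳ (fun μ => if μ = γ + α then .id else 0) ∘ₗ f, by
    intro α x hx
    rw [gradedLift_apply 𝒮 _ hx, LinearMap.comp_apply]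
    induction f x using DirectSum.Decomposition.inductionOn ℳ with
    | zero => simp
    | homogeneous m =>
      rw [gradedLift_apply ℳ _ m.2]
      split_ifs with h
      · simp [← h]
      · simp
    | add m m' h h' => rw [map_add]; exact Submodule.add_mem _ h h'⟩
  map_add' f g := by
    ext1
    refine linearMap_ext_of_homogeneous 𝒮 fun α x hx => ?_
    simp [gradedLift_apply 𝒮 _ hx]
  map_smul' c f := by
    ext1
    refine linearMap_ext_of_homogeneous 𝒮 fun α x hx => ?_
    simp [gradedLift_apply 𝒮 _ hx]

theorem homProj_apply (γ : Γ) (f : S →ₗ[k] M) {α : Γ} {x : S} (hx : x ∈ 𝒮 α) :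
    (homProj 𝒮 ℳ γ f : S →ₗ[k] M) x =
      gradedLift ℳ (fun μ => if μ = γ + α then .id else 0) (f x) := by
  simp [homProj, gradedLift_apply 𝒮 _ hx]

theorem finite_degrees {Γ k S : Type*} [DecidableEq Γ] [Field k] [AddCommGroup S] [Module k S]
    (𝒱 : Γ → Submodule k S) [DirectSum.Decomposition 𝒱] [FiniteDimensional k S] : {γ | 𝒱 γ ≠ ⊥}.Finite :=
  WellFoundedGT.finite_ne_bot_of_iSupIndep
    (DirectSum.Decomposition.isInternal 𝒱).submodule_iSupIndep

variable [FiniteDimensional k S] [FiniteDimensional k M]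

/-- `Hom(S, M) = ⨁ Hom_γ(S, M)` for finite-dimensional graded spaces. -/
noncomputable instance homDecomposition : DirectSum.Decomposition (homDeg 𝒮 ℳ) :=
  let T : Finset Γ := Finset.image₂ (fun μ α => μ - α)
    (finite_degrees ℳ).toFinset (finite_degrees 𝒮).toFinset
  have hT : ∀ {γ α : Γ} {x : S}, x ∈ 𝒮 α → x ≠ 0 → ∀ {m : M}, m ∈ ℳ (γ + α) → m ≠ 0 →
      γ ∈ T := by
    intro γ α x hx hx0 m hm hm0
    refine Finset.mem_image₂.2 ⟨γ + α, ?_, α, ?_, by abel⟩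
    · simpa using fun h : ℳ (γ + α) = ⊥ => hm0 (by simpa [h] using hm)
    · simpa using fun h : 𝒮 α = ⊥ => hx0 (by simpa [h] using hx)
  DirectSum.Decomposition.ofLinearMap (homDeg 𝒮 ℳ)
    (∑ γ ∈ T, DirectSum.lof k Γ (fun γ => homDeg 𝒮 ℳ γ) γ ∘ₗ homProj 𝒮 ℳ γ)
    (by
      ext1 f
      simp only [LinearMap.comp_apply, LinearMap.sum_apply, map_sum, DirectSum.coeLinearMap_lof,
        LinearMap.id_apply]
      refine linearMap_ext_of_homogeneous 𝒮 fun α x hx => ?_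
      rw [LinearMap.sum_apply]
      simp only [homProj_apply 𝒮 ℳ _ f hx]
      by_cases hx0 : x = 0
      · simp [hx0]
      induction f x using DirectSum.Decomposition.inductionOn ℳ with
      | zero => simp
      | @homogeneous μ m =>
        simp only [gradedLift_apply ℳ _ m.2]
        by_cases hm : (m : M) = 0
        · simp [hm]
        · rw [Finset.sum_eq_single (μ - α)]
          · simp
          · intro γ _ hγ
            rw [if_neg (by rintro rfl; exact hγ (by abel))]
            simp
          · intro h
            exact absurd (hT (γ := μ - α) hx hx0 (m := m) (by simp) hm) h
      | add m m' h h' => simp only [map_add, Finset.sum_add_distrib, h, h'])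
    (by
      ext γ f : 2
      simp only [LinearMap.comp_apply, LinearMap.sum_apply, DirectSum.coeLinearMap_lof,
        LinearMap.id_apply]
      have hp : ∀ γ', homProj 𝒮 ℳ γ' (f : S →ₗ[k] M) = if h : γ = γ' then h ▸ f else 0 := by
        intro γ'
        ext1
        refine linearMap_ext_of_homogeneous 𝒮 fun α x hx => ?_
        rw [homProj_apply 𝒮 ℳ _ _ hx, gradedLift_apply ℳ _ (f.2 α x hx)]
        by_cases h : γ = γ'
        · subst h; simp
        · simp [h]
      by_cases hγ : γ ∈ T
      · rw [Finset.sum_eq_single γ]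
        · rw [hp]; simp
        · intro γ' _ h
          rw [hp, dif_neg (Ne.symm h), map_zero]
        · exact fun h => absurd hγ h
      · have hf : f = 0 := by
          ext1
          refine linearMap_ext_of_homogeneous 𝒮 fun α x hx => ?_
          by_contra hne
          refine hγ (hT hx ?_ (f.2 α x hx) hne)
          rintro rfl
          simp at hne
        simp [hf])

namespace Bimodule

variable {ε : CommutationFactor Γ k} {𝒮 ℳ} {A : LeftSymmetricAlgebra ε 𝒮} (B : Bimodule A ℳ)

/-- The left action of `S` on `C¹(S, M) = Hom(S, M)`:
`(x · f)(y) = x · f(y) - ε(α, γ) f(x · y) + ε(α, γ) f(x) · y` for `x ∈ S_α` and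
`f ∈ Hom_γ(S, M)`, extended bilinearly. -/
noncomputable def homAct : S →ₗ[k] (S →ₗ[k] M) →ₗ[k] (S →ₗ[k] M) :=
  gradedLift 𝒮 fun α => (gradedLift (homDeg 𝒮 ℳ) fun γ =>
    LinearMap.mk₂ k (fun f x => B.left x ∘ₗ f - ε α γ • (f ∘ₗ A.mul x) + ε α γ • B.right (f x))
      (by intros; ext; simp; module) (by intros; ext; simp; module)
      (by intros; ext; simp; module) (by intros; ext; simp; module)).flip

theorem homAct_apply {α γ : Γ} {x : S} {f : S →ₗ[k] M} (hx : x ∈ 𝒮 α) (hf : f ∈ homDeg 𝒮 ℳ γ)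
    (y : S) : B.homAct x f y =
      B.left x (f y) - ε α γ • f (A.mul x y) + ε α γ • B.right (f x) y := by
  rw [homAct, gradedLift_apply 𝒮 _ hx, LinearMap.flip_apply, gradedLift_apply _ _ hf]
  simp

theorem homAct_mem {α γ : Γ} {x : S} {f : S →ₗ[k] M} (hx : x ∈ 𝒮 α) (hf : f ∈ homDeg 𝒮 ℳ γ) :
    B.homAct x f ∈ homDeg 𝒮 ℳ (α + γ) := by
  intro β y hy
  rw [B.homAct_apply hx hf]
  have h1 := B.left_mem hx (hf β y hy)
  have h2 := hf _ _ (A.mul_mem hx hy)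
  have h3 := B.right_mem (hf α x hx) hy
  have e1 : α + (γ + β) = α + γ + β := by abel
  have e2 : γ + (α + β) = α + γ + β := by abel
  have e3 : γ + α + β = α + γ + β := by abel
  rw [e1] at h1; rw [e2] at h2; rw [e3] at h3
  exact Submodule.add_mem _ (Submodule.sub_mem _ h1 (Submodule.smul_mem _ _ h2))
    (Submodule.smul_mem _ _ h3)

/-- `C¹(S, M) = Hom(S, M)` as a module over `𝔤_S`. -/
noncomputable def homModule : EpsLieModule A.lie (homDeg 𝒮 ℳ) where
  act := B.homAct
  isModule := {
    act_mem := B.homAct_mem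
    act_bracket := by
      intro α β x y hx hy f
      induction f using DirectSum.Decomposition.inductionOn (homDeg 𝒮 ℳ) with
      | zero => simp
      | add f g hf hg => simp only [map_add, hf, hg]; module
      | @homogeneous γ f =>
        obtain ⟨f, hf⟩ := f
        refine linearMap_ext_of_homogeneous 𝒮 fun δ z hz => ?_
        simp only [LinearMap.sub_apply, LinearMap.smul_apply]
        have hc : A.lie.bracket x y = A.mul x y - ε α β • A.mul y x := A.commutator_apply hx hy
        rw [B.homAct_apply (A.lie.bracket_mem hx hy) hf, B.homAct_apply hx (B.homAct_mem hy hf),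
          B.homAct_apply hy (B.homAct_mem hx hf), B.homAct_apply hy hf, B.homAct_apply hy hf,
          B.homAct_apply hy hf, B.homAct_apply hx hf, B.homAct_apply hx hf,
          B.homAct_apply hx hf, hc]
        have e1 := ε.mul_swap α β
        have h1 := A.left_symm hx hy z
        have h2 := B.left_left hx hy (f z)
        have h3 := B.left_right hx (hf _ y hy) z
        have h4 := B.left_right hy (hf _ x hx) z
        simp only [ε.add_right, ε.add_left, map_sub, map_smul, map_add, LinearMap.sub_apply,
          LinearMap.smul_apply, LinearMap.add_apply] at h3 h4 ⊢
        have h1' := congrArg f h1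
        simp only [map_sub, map_smul] at h1'
        rw [sub_eq_iff_eq_add] at h1' h2 h3 h4
        rw [h1', h2, h3, h4]
        match_scalars <;> grind }

end Bimodule

end HomSpace

section Combinatorics

/-! The `ε`-skew symmetry of the coboundary and of the action, on tuples of homogeneous
elements: `E` is the type of homogeneous elements, with degree `deg` and bracket `br`. -/

variable {Γ k : Type*} [AddCommGroup Γ] [Field k] (ε : CommutationFactor Γ k)
variable {E W : Type*} [AddCommGroup W] [Module k W] (deg : E → Γ) (br : E → E → E)

def TupleSkew {n : ℕ} (F : (Fin n → E) → W) : Prop :=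
  ∀ (x : Fin n → E) (p q : Fin n), (p : ℕ) + 1 = q →
    F x = -(ε (deg (x p)) (deg (x q)) • F (x ∘ Equiv.swap p q))

def BracketSkew {n : ℕ} (F : (Fin n → E) → W) : Prop :=
  ∀ (x : Fin n → E) (j : Fin n) (a b : E),
    F (Function.update x j (br a b)) = -(ε (deg a) (deg b) • F (Function.update x j (br b a)))

def tupleAct {n : ℕ} (u : E) (F : (Fin n → E) → W) (y : Fin n → E) : W :=
  ∑ j, ε (deg u) (∑ s with s < j, deg (y s)) • F (Function.update y j (br u (y j)))

def tupleCobound {n : ℕ} (β : Γ) (P : E → (Fin n → E) → W) (F : (Fin n → E) → W)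
    (x : Fin (n + 1) → E) : W :=
  ∑ t : Fin (n + 1), (-1 : k) ^ (t : ℕ) •
    (ε (β + ∑ s with s < t, deg (x s)) (deg (x t)) • P (x t) (t.removeNth x) -
      ∑ j : Fin n with t < t.succAbove j,
        ε (deg (x t)) (∑ s with t < s ∧ s < t.succAbove j, deg (x s)) •
          F (Function.update (t.removeNth x) j (br (x t) (x (t.succAbove j)))))

variable {ε deg br}

theorem tupleSkew_cons {n : ℕ} {F : (Fin (n + 1) → E) → W}
    (h : ∀ a, TupleSkew ε deg (fun r => F (Fin.cons a r)))
    (h0 : ∀ (x : Fin (n + 1) → E) (hn : 0 < n),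
      F x = -(ε (deg (x 0)) (deg (x ⟨1, by omega⟩)) •
        F (x ∘ Equiv.swap 0 ⟨1, by omega⟩))) : TupleSkew ε deg F := by
  intro x p q hpq
  cases p using Fin.cases with
  | zero =>
    have hn : 0 < n := by have := q.2; simp at hpq; omega
    have : q = ⟨1, by omega⟩ := by ext; simpa using hpq.symm
    rw [this]
    exact h0 x hn
  | succ p =>
    cases q using Fin.cases with
    | zero => simp at hpq
    | succ q =>
      have := h (x 0) (Fin.tail x) p q (by simpa using hpq)
      simp only [Fin.cons_self_tail] at this
      rw [this]
      have e : (Fin.cons (x 0) (Fin.tail x ∘ Equiv.swap p q) : Fin (n + 1) → E) =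
          x ∘ Equiv.swap p.succ q.succ := by
        funext s
        cases s using Fin.cases with
        | zero => simp [Equiv.swap_apply_of_ne_of_ne (Fin.succ_ne_zero p).symm
            (Fin.succ_ne_zero q).symm]
        | succ s =>
          simp only [Fin.cons_succ, Function.comp_apply, Fin.tail]
          congr 1
          simp only [Equiv.swap_apply_def, Fin.succ_inj]
          split_ifs <;> rfl
      rw [e]
      rfl

theorem TupleSkew.cons {n : ℕ} {F : (Fin (n + 1) → E) → W} (h : TupleSkew ε deg F) (a : E) :
    TupleSkew ε deg (fun r => F (Fin.cons a r)) := by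
  intro x p q hpq
  have := h (Fin.cons a x) p.succ q.succ (by simpa using hpq)
  simp only [Fin.cons_succ] at this
  refine this.trans ?_
  congr 3
  funext s
  cases s using Fin.cases with
  | zero => simp [Equiv.swap_apply_of_ne_of_ne (Fin.succ_ne_zero p).symm
      (Fin.succ_ne_zero q).symm]
  | succ s =>
    simp only [Fin.cons_succ, Function.comp_apply]
    rw [← Fin.cons_succ (α := fun _ => E) a x]
    congr 1
    simp only [Equiv.swap_apply_def, Fin.succ_inj]
    split_ifs <;> rfl

theorem cons_cons_swap {n : ℕ} (a b : E) (r : Fin n → E) :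
    (Fin.cons a (Fin.cons b r) : Fin (n + 2) → E) ∘ Equiv.swap 0 ⟨1, by omega⟩ =
      Fin.cons b (Fin.cons a r) := by
  funext s
  refine Fin.cases ?_ (fun s => Fin.cases ?_ (fun s => ?_) s) s
  · rw [Function.comp_apply, Equiv.swap_apply_left]; rfl
  · have : (Fin.succ 0 : Fin (n + 2)) = ⟨1, by omega⟩ := rfl
    rw [Function.comp_apply, this, Equiv.swap_apply_right]; rfl
  · rw [Function.comp_apply, Equiv.swap_apply_of_ne_of_ne]
    · rfl
    · exact Fin.succ_ne_zero _
    · intro h; simp [Fin.ext_iff] at h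

theorem TupleSkew.cons_cons {n : ℕ} {F : (Fin (n + 2) → E) → W} (h : TupleSkew ε deg F)
    (a b : E) (r : Fin n → E) : F (Fin.cons a (Fin.cons b r)) =
      -(ε (deg a) (deg b) • F (Fin.cons b (Fin.cons a r))) := by
  have := h (Fin.cons a (Fin.cons b r)) 0 ⟨1, by omega⟩ (by simp)
  rwa [cons_cons_swap] at this

theorem tupleSkew_cons_cons {n : ℕ} {F : (Fin (n + 2) → E) → W}
    (h : ∀ a, TupleSkew ε deg (fun r => F (Fin.cons a r)))
    (h0 : ∀ (a b : E) (r : Fin n → E), F (Fin.cons a (Fin.cons b r)) =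
      -(ε (deg a) (deg b) • F (Fin.cons b (Fin.cons a r)))) : TupleSkew ε deg F := by
  refine tupleSkew_cons h fun x _ => ?_
  have hx : x = Fin.cons (x 0) (Fin.cons (x ⟨1, by omega⟩) (Fin.tail (Fin.tail x))) := by
    funext s
    refine Fin.cases ?_ (fun s => Fin.cases ?_ (fun s => ?_) s) s <;> rfl
  have := h0 (x 0) (x ⟨1, by omega⟩) (Fin.tail (Fin.tail x))
  rwa [← cons_cons_swap (x 0), ← hx] at this

theorem BracketSkew.cons {n : ℕ} {F : (Fin (n + 1) → E) → W} (h : BracketSkew ε deg br F)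
    (a : E) : BracketSkew ε deg br (fun r => F (Fin.cons a r)) := by
  intro x j b c
  have := h (Fin.cons a x) j.succ b c
  rwa [← Fin.cons_update, ← Fin.cons_update] at this

theorem tupleAct_cons {n : ℕ} (u a : E) (F : (Fin (n + 1) → E) → W) (r : Fin n → E) :
    tupleAct ε deg br u F (Fin.cons a r) = F (Fin.cons (br u a) r) +
      ε (deg u) (deg a) • tupleAct ε deg br u (fun r => F (Fin.cons a r)) r := by
  simp only [tupleAct, Fin.sum_univ_succ, Finset.smul_sum, Finset.sum_filter]
  congr 1
  · simp [ε.zero_right]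
  · refine Finset.sum_congr rfl fun j _ => ?_
    simp [ε.add_right, smul_smul, Fin.cons_update]

theorem tupleSkew_tupleAct (hbr : ∀ a b, deg (br a b) = deg a + deg b) {n : ℕ} (u : E)
    {F : (Fin n → E) → W} (h : TupleSkew ε deg F) : TupleSkew ε deg (tupleAct ε deg br u F) := by
  induction n with
  | zero => intro x p; exact p.elim0
  | succ n ih =>
    cases n with
    | zero => intro x p q hpq; omega
    | succ n =>
      refine tupleSkew_cons_cons (fun a => ?_) (fun a b r => ?_)
      · intro x p q hpq
        have h1 := (h.cons (br u a)) x p q hpq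
        have h2 := ih (h.cons a) x p q hpq
        simp only [tupleAct_cons] at h1 h2 ⊢
        rw [h1, h2]
        module
      · simp only [tupleAct_cons]
        have h1 := h.cons_cons (br u a) b r
        have h2 := h.cons_cons a (br u b) r
        have h3 : tupleAct ε deg br u (fun r => F (Fin.cons a (Fin.cons b r))) r =
            -(ε (deg a) (deg b) •
              tupleAct ε deg br u (fun r => F (Fin.cons b (Fin.cons a r))) r) := by
          simp only [tupleAct, Finset.smul_sum, ← Finset.sum_neg_distrib]
          refine Finset.sum_congr rfl fun j _ => ?_
          rw [h.cons_cons a b]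
          module
        rw [h1, h2, h3, hbr, hbr, ε.add_left, ε.add_right]
        have e := ε.mul_swap (deg u) (deg a)
        match_scalars <;> grind

theorem tupleCobound_cons {n : ℕ} (β : Γ) (P : E → (Fin (n + 1) → E) → W)
    (F : (Fin (n + 1) → E) → W) (a : E) (r : Fin (n + 1) → E) :
    tupleCobound ε deg br β P F (Fin.cons a r) =
      ε β (deg a) • P a r - tupleAct ε deg br a F r -
        tupleCobound ε deg br (β + deg a) (fun u y => P u (Fin.cons a y))
          (fun y => F (Fin.cons a y)) r := by
  rw [tupleCobound, Fin.sum_univ_succ, sub_eq_add_neg (_ - _) (tupleCobound _ _ _ _ _ _ _)]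
  congr 1
  · have h0 : ∀ j : Fin (n + 1), (∑ s with (0 : Fin (n + 2)) < s ∧ s < Fin.succAbove 0 j,
        deg ((Fin.cons a r : Fin (n + 2) → E) s)) = ∑ s with s < j, deg (r s) := by
      intro j
      rw [Finset.sum_filter, Fin.sum_univ_succ, Finset.sum_filter]
      simp
    have h1 : (∑ s with s < (0 : Fin (n + 2)), deg ((Fin.cons a r : Fin (n + 2) → E) s)) = 0 := by
      simp
    simp only [h0, h1]
    simp only [Fin.removeNth_zero, Fin.succAbove_zero, Fin.succ_pos, Finset.filter_true,
      Fin.cons_zero, Fin.cons_succ, Fin.tail_cons, Fin.val_zero, pow_zero, one_smul, add_zero,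
      tupleAct]
  · rw [tupleCobound, ← Finset.sum_neg_distrib]
    refine Finset.sum_congr rfl fun t _ => ?_
    have hr : (Fin.removeNth t.succ (Fin.cons a r : Fin (n + 2) → E) : Fin (n + 1) → E) =
        Fin.cons a (t.removeNth r) := by
      funext s
      cases s using Fin.cases with
      | zero => simp [Fin.removeNth]
      | succ s => simp [Fin.removeNth]
    have h1 : (∑ s with s < t.succ, deg ((Fin.cons a r : Fin (n + 2) → E) s)) =
        deg a + ∑ s with s < t, deg (r s) := by
      rw [Finset.sum_filter, Fin.sum_univ_succ, Finset.sum_filter]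
      simp
    have h2 : ∀ j : Fin n, (∑ s with t.succ < s ∧ s < t.succ.succAbove j.succ,
        deg ((Fin.cons a r : Fin (n + 2) → E) s)) =
          ∑ s with t < s ∧ s < t.succAbove j, deg (r s) := by
      intro j
      rw [Finset.sum_filter, Fin.sum_univ_succ, Finset.sum_filter]
      simp
    have h3 : ∀ G : Fin (n + 1) → W, (∑ j with t.succ < t.succ.succAbove j, G j) =
        ∑ j : Fin n with t < t.succAbove j, G j.succ := by
      intro G
      rw [Finset.sum_filter, Fin.sum_univ_succ, Finset.sum_filter]
      simp
    rw [hr, h1, h3]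
    simp only [h2]
    simp only [Fin.val_succ, pow_succ, Fin.cons_succ, Fin.succ_succAbove_succ,
      Fin.cons_update, add_assoc]
    module

theorem tupleCobound_zero (β : Γ) (P : E → (Fin 0 → E) → W) (F : (Fin 0 → E) → W) (a : E)
    (r : Fin 0 → E) : tupleCobound ε deg br β P F (Fin.cons a r) = ε β (deg a) • P a r := by
  simp [tupleCobound]

theorem tupleSkew_tupleCobound (hbr : ∀ a b, deg (br a b) = deg a + deg b) {n : ℕ} (β : Γ)
    {P : E → (Fin n → E) → W} {F : (Fin n → E) → W} (hP : ∀ u, TupleSkew ε deg (P u))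
    (hF : TupleSkew ε deg F) (hF' : BracketSkew ε deg br F) :
    TupleSkew ε deg (tupleCobound ε deg br β P F) := by
  induction n generalizing β with
  | zero => intro x p q hpq; omega
  | succ n ih =>
    refine tupleSkew_cons_cons (fun a => ?_) (fun a b r => ?_)
    · intro x p q hpq
      have h1 := hP a x p q hpq
      have h2 := tupleSkew_tupleAct hbr a hF x p q hpq
      have h3 := ih (β + deg a) (fun u => (hP u).cons a) (hF.cons a) (hF'.cons a) x p q hpq
      simp only [tupleCobound_cons]
      rw [h1, h2, h3]
      module
    · have hb : F (Fin.cons (br a b) r) = -(ε (deg a) (deg b) • F (Fin.cons (br b a) r)) := by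
        simpa [Fin.update_cons_zero] using hF' (Fin.cons a r) 0 a b
      have e := ε.mul_swap (deg a) (deg b)
      simp only [tupleCobound_cons, tupleAct_cons, hb]
      cases n with
      | zero =>
        simp only [tupleCobound_zero, tupleAct, Finset.univ_eq_empty, Finset.sum_empty,
          ε.add_left]
        match_scalars <;> grind
      | succ n =>
        have h3 : tupleCobound ε deg br (β + deg a + deg b)
            (fun u y => P u (Fin.cons a (Fin.cons b y)))
            (fun y => F (Fin.cons a (Fin.cons b y))) r = -(ε (deg a) (deg b) •
              tupleCobound ε deg br (β + deg b + deg a)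
                (fun u y => P u (Fin.cons b (Fin.cons a y)))
                (fun y => F (Fin.cons b (Fin.cons a y))) r) := by
          rw [show β + deg b + deg a = β + deg a + deg b by abel]
          simp only [tupleCobound, Finset.smul_sum, ← Finset.sum_neg_distrib, hF.cons_cons a b,
            (hP _).cons_cons a b]
          refine Finset.sum_congr rfl fun t _ => ?_
          simp only [smul_neg, Finset.sum_neg_distrib, smul_sub, Finset.smul_sum, smul_smul]
          simp only [mul_comm, mul_left_comm]
          module
        simp only [tupleCobound_cons, h3, ε.add_left]
        match_scalars <;> grind

end Combinatorics

section Cochains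

variable {Γ k : Type*} [AddCommGroup Γ] [Field k]
variable {V W U : Type*} [AddCommGroup V] [Module k V] [AddCommGroup W] [Module k W]
  [AddCommGroup U] [Module k U]

/-- The multilinear maps `f` of `n` variables that are homogeneous of degree `β` and `ε`-skew
symmetric in the first `m` variables:
`f(…, x_p, x_{p+1}, …) = -ε(α_p, α_{p+1}) f(…, x_{p+1}, x_p, …)` on homogeneous arguments.
For `m = n` this is `Hom_β(⋀_ε^n V, W)`; for `n = m + 1` it is `Hom_β(⋀_ε^m V ⊗ V, W)`. -/
def cochains (ε : CommutationFactor Γ k) (𝒱 : Γ → Submodule k V) (𝒲 : Γ → Submodule k W)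
    (n m : ℕ) (β : Γ) : Submodule k (MultilinearMap k (fun _ : Fin n => V) W) where
  carrier := {f | ∀ (α : Fin n → Γ) (x : Fin n → V), (∀ s, x s ∈ 𝒱 (α s)) →
    f x ∈ 𝒲 (β + ∑ s, α s) ∧
    ∀ p q : Fin n, (p : ℕ) + 1 = q → (q : ℕ) < m →
      f x = -(ε (α p) (α q) • f (x ∘ Equiv.swap p q))}
  add_mem' {f g} hf hg α x hx :=
    ⟨Submodule.add_mem _ (hf α x hx).1 (hg α x hx).1, fun p q hpq hq => by
      rw [add_apply, add_apply, (hf α x hx).2 p q hpq hq,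
        (hg α x hx).2 p q hpq hq]
      module⟩
  zero_mem' α x _ := ⟨Submodule.zero_mem _, fun p q _ _ => by simp⟩
  smul_mem' c f hf α x hx :=
    ⟨Submodule.smul_mem _ c (hf α x hx).1, fun p q hpq hq => by
      rw [smul_apply, smul_apply, (hf α x hx).2 p q hpq hq]
      module⟩

/-- The elements of `cochains ε 𝒱 𝒲 n m β`, as a vector space. -/
def CochainSpace (ε : CommutationFactor Γ k) (𝒱 : Γ → Submodule k V) (𝒲 : Γ → Submodule k W)
    (n m : ℕ) (β : Γ) : Type _ := ↥(cochains ε 𝒱 𝒲 n m β)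

namespace CochainSpace

variable {ε : CommutationFactor Γ k} {𝒱 : Γ → Submodule k V} {𝒲 : Γ → Submodule k W}
  {n m : ℕ} {β : Γ}

instance : AddCommGroup (CochainSpace ε 𝒱 𝒲 n m β) :=
  inferInstanceAs (AddCommGroup ↥(cochains ε 𝒱 𝒲 n m β))

instance : Module k (CochainSpace ε 𝒱 𝒲 n m β) :=
  inferInstanceAs (Module k ↥(cochains ε 𝒱 𝒲 n m β))

/-- The underlying multilinear map. -/
def map (f : CochainSpace ε 𝒱 𝒲 n m β) : MultilinearMap k (fun _ : Fin n => V) W := f.1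

theorem map_mem (f : CochainSpace ε 𝒱 𝒲 n m β) : f.map ∈ cochains ε 𝒱 𝒲 n m β := f.2

/-- The cochain given by a multilinear map with the required properties. -/
def mk (f : MultilinearMap k (fun _ : Fin n => V) W) (hf : f ∈ cochains ε 𝒱 𝒲 n m β) :
    CochainSpace ε 𝒱 𝒲 n m β := ⟨f, hf⟩

theorem map_mk {f : MultilinearMap k (fun _ : Fin n => V) W} (hf : f ∈ cochains ε 𝒱 𝒲 n m β) :
    (mk f hf).map = f := rfl

theorem map_add (f g : CochainSpace ε 𝒱 𝒲 n m β) : (f + g).map = f.map + g.map := rfl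

theorem map_smul (c : k) (f : CochainSpace ε 𝒱 𝒲 n m β) : (c • f).map = c • f.map := rfl

theorem ext {f g : CochainSpace ε 𝒱 𝒲 n m β} (h : f.map = g.map) : f = g := Subtype.ext h

end CochainSpace

/-- `(x_0, …, x_n) ↦ b(x_t, f(x_0, …, x̂_t, …, x_n))`. -/
def insertAct {n : ℕ} (b : V →ₗ[k] W →ₗ[k] U) (f : MultilinearMap k (fun _ : Fin n => V) W)
    (t : Fin (n + 1)) : MultilinearMap k (fun _ : Fin (n + 1) => V) U :=
  MultilinearMap.mk' (fun x => b (x t) (f (t.removeNth x)))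
    (by
      intro x i v w
      rcases Fin.eq_self_or_eq_succAbove t i with rfl | ⟨l, rfl⟩
      · simp
      · simp [Fin.removeNth_update_succAbove])
    (by
      intro x i c v
      rcases Fin.eq_self_or_eq_succAbove t i with rfl | ⟨l, rfl⟩
      · simp
      · simp [Fin.removeNth_update_succAbove])

/-- `(x_0, …, x_n) ↦ f(x_0, …, x̂_t, …, b(x_t, x_{j'}), …, x_n)`, where `b(x_t, x_{j'})` replaces
the `j`-th entry `x_{j'}` of the tuple without `x_t`. -/
def insertBracket {n : ℕ} (b : V →ₗ[k] V →ₗ[k] V) (f : MultilinearMap k (fun _ : Fin n => V) W)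
    (t : Fin (n + 1)) (j : Fin n) : MultilinearMap k (fun _ : Fin (n + 1) => V) W :=
  MultilinearMap.mk'
    (fun x => f (Function.update (t.removeNth x) j (b (x t) (x (t.succAbove j)))))
    (by
      intro x i v w
      rcases Fin.eq_self_or_eq_succAbove t i with rfl | ⟨l, rfl⟩
      · simp
      · rcases eq_or_ne l j with rfl | hl
        · simp [Fin.removeNth_update_succAbove]
        · have : t.succAbove j ≠ t.succAbove l := fun h => hl (Fin.succAbove_right_injective h).symm
          simp [Fin.removeNth_update_succAbove, this, Function.update_comm hl])
    (by
      intro x i c v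
      rcases Fin.eq_self_or_eq_succAbove t i with rfl | ⟨l, rfl⟩
      · simp
      · rcases eq_or_ne l j with rfl | hl
        · simp [Fin.removeNth_update_succAbove]
        · have : t.succAbove j ≠ t.succAbove l := fun h => hl (Fin.succAbove_right_injective h).symm
          simp [Fin.removeNth_update_succAbove, this, Function.update_comm hl])

/-- `(x_0, …, x_n) ↦ b(f(x_0, …, x̂_t, …, x_t, …, x_n), x_{j'})`, where `x_t` replaces the `j`-th
entry `x_{j'}` of the tuple without `x_t`. -/
def insertRight {n : ℕ} (b : W →ₗ[k] V →ₗ[k] U) (f : MultilinearMap k (fun _ : Fin n => V) W)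
    (t : Fin (n + 1)) (j : Fin n) : MultilinearMap k (fun _ : Fin (n + 1) => V) U :=
  MultilinearMap.mk'
    (fun x => b (f (Function.update (t.removeNth x) j (x t))) (x (t.succAbove j)))
    (by
      intro x i v w
      rcases Fin.eq_self_or_eq_succAbove t i with rfl | ⟨l, rfl⟩
      · simp
      · rcases eq_or_ne l j with rfl | hl
        · simp [Fin.removeNth_update_succAbove]
        · have : t.succAbove j ≠ t.succAbove l := fun h => hl (Fin.succAbove_right_injective h).symm
          simp [Fin.removeNth_update_succAbove, this, Function.update_comm hl])
    (by
      intro x i c v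
      rcases Fin.eq_self_or_eq_succAbove t i with rfl | ⟨l, rfl⟩
      · simp
      · rcases eq_or_ne l j with rfl | hl
        · simp [Fin.removeNth_update_succAbove]
        · have : t.succAbove j ≠ t.succAbove l := fun h => hl (Fin.succAbove_right_injective h).symm
          simp [Fin.removeNth_update_succAbove, this, Function.update_comm hl])

/-- `(x_1, …, x_n) ↦ f(x_1, …, φ(x_j), …, x_n)`. -/
def applyAt {n : ℕ} (φ : V →ₗ[k] V) (f : MultilinearMap k (fun _ : Fin n => V) W)
    (j : Fin n) : MultilinearMap k (fun _ : Fin n => V) W :=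
  MultilinearMap.mk' (fun x => f (Function.update x j (φ (x j))))
    (by
      intro x i v w
      rcases eq_or_ne i j with rfl | hi
      · simp
      · simp [hi.symm, Function.update_comm hi])
    (by
      intro x i c v
      rcases eq_or_ne i j with rfl | hi
      · simp
      · simp [hi.symm, Function.update_comm hi])

/-- `(x_1, …, x_n) ↦ b(f(x_1, …, u, …, x_n), x_j)`, where `u` replaces `x_j`. -/
def replaceAt {n : ℕ} (b : W →ₗ[k] V →ₗ[k] U) (u : V)
    (f : MultilinearMap k (fun _ : Fin n => V) W) (j : Fin n) :
    MultilinearMap k (fun _ : Fin n => V) U :=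
  MultilinearMap.mk' (fun x => b (f (Function.update x j u)) (x j))
    (by
      intro x i v w
      rcases eq_or_ne i j with rfl | hi
      · simp
      · simp [hi.symm, Function.update_comm hi])
    (by
      intro x i c v
      rcases eq_or_ne i j with rfl | hi
      · simp
      · simp [hi.symm, Function.update_comm hi])

section
variable {n : ℕ} (f : MultilinearMap k (fun _ : Fin n => V) W)

theorem insertAct_apply (b : V →ₗ[k] W →ₗ[k] U) (t : Fin (n + 1)) (x : Fin (n + 1) → V) :
    insertAct b f t x = b (x t) (f (t.removeNth x)) := rfl

theorem insertBracket_apply (b : V →ₗ[k] V →ₗ[k] V) (t : Fin (n + 1)) (j : Fin n)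
    (x : Fin (n + 1) → V) : insertBracket b f t j x =
      f (Function.update (t.removeNth x) j (b (x t) (x (t.succAbove j)))) := rfl

theorem insertRight_apply (b : W →ₗ[k] V →ₗ[k] U) (t : Fin (n + 1)) (j : Fin n)
    (x : Fin (n + 1) → V) : insertRight b f t j x =
      b (f (Function.update (t.removeNth x) j (x t))) (x (t.succAbove j)) := rfl

theorem applyAt_apply (φ : V →ₗ[k] V) (j : Fin n) (x : Fin n → V) :
    applyAt φ f j x = f (Function.update x j (φ (x j))) := rfl

theorem replaceAt_apply (b : W →ₗ[k] V →ₗ[k] U) (u : V) (j : Fin n) (x : Fin n → V) :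
    replaceAt b u f j x = b (f (Function.update x j u)) (x j) := rfl

end

section
variable {ε : CommutationFactor Γ k} {𝒱 : Γ → Submodule k V} {𝒲 : Γ → Submodule k W}

theorem map_mem_of_update {n m : ℕ} {β : Γ} {f : MultilinearMap k (fun _ : Fin n => V) W}
    (hf : f ∈ cochains ε 𝒱 𝒲 n m β) {α : Fin n → Γ} {x : Fin n → V}
    (hx : ∀ s, x s ∈ 𝒱 (α s)) (j : Fin n) {v : V} {δ μ : Γ} (hv : v ∈ 𝒱 δ)
    (hμ : μ + α j = β + ∑ s, α s + δ) : f (Function.update x j v) ∈ 𝒲 μ := by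
  have h := (hf (Function.update α j δ) (Function.update x j v) (fun s => by
    rcases eq_or_ne s j with rfl | hs
    · simpa using hv
    · simpa [hs] using hx s)).1
  rw [Finset.sum_update_of_mem (Finset.mem_univ j)] at h
  rw [← Finset.sum_sdiff (Finset.subset_univ {j}), Finset.sum_singleton] at hμ
  have : μ = β + (δ + ∑ s ∈ Finset.univ \ {j}, α s) :=
    add_right_cancel (b := α j) (by rw [hμ]; abel)
  rwa [this]

end

end Cochains

section Total

variable {Γ k : Type*} [AddCommGroup Γ] [DecidableEq Γ] [Field k]
variable {V : Type*} [AddCommGroup V] [Module k V] (𝒱 : Γ → Submodule k V)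
  [DirectSum.Decomposition 𝒱]
variable {C : Γ → Type*} [∀ β, AddCommGroup (C β)] [∀ β, Module k (C β)]

/-- The bilinear action of `V` on `⨁ C_β` with components `V_α × C_β → C_{α + β}`. -/
noncomputable def totalAct (φ : ∀ α β, 𝒱 α →ₗ[k] C β →ₗ[k] C (α + β)) :
    V →ₗ[k] (⨁ β, C β) →ₗ[k] (⨁ β, C β) :=
  DirectSum.toModule k Γ ((⨁ β, C β) →ₗ[k] (⨁ β, C β))
    (fun α => (DirectSum.toModule k Γ (𝒱 α →ₗ[k] (⨁ β, C β))
      (fun β => ((φ α β).compr₂ (DirectSum.lof k Γ C (α + β))).flip)).flip) ∘ₗ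
    (DirectSum.decomposeLinearEquiv 𝒱).toLinearMap

theorem totalAct_lof (φ : ∀ α β, 𝒱 α →ₗ[k] C β →ₗ[k] C (α + β)) {α β : Γ} (x : 𝒱 α) (f : C β) :
    totalAct 𝒱 φ x (DirectSum.lof k Γ C β f) = DirectSum.lof k Γ C (α + β) (φ α β x f) := by
  simp [totalAct]

/-- The homogeneous subspaces of `⨁ C_β`. -/
def totalDeg (k : Type*) [Field k] {Γ : Type*} [DecidableEq Γ] (C : Γ → Type*)
    [∀ β, AddCommGroup (C β)] [∀ β, Module k (C β)] (β : Γ) : Submodule k (⨁ β, C β) :=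
  LinearMap.range (DirectSum.lof k Γ C β)

end Total

section Lie

variable {Γ k : Type*} [AddCommGroup Γ] [DecidableEq Γ] [Field k] {ε : CommutationFactor Γ k}
variable {V W : Type*} [AddCommGroup V] [Module k V] [AddCommGroup W] [Module k W]
variable {𝒱 : Γ → Submodule k V} [DirectSum.Decomposition 𝒱] {𝒲 : Γ → Submodule k W}

/-- The bracket of homogeneous elements, with its degree. -/
def EpsLieAlgebra.brHom (𝔤 : EpsLieAlgebra ε 𝒱) (a b : (α : Γ) × 𝒱 α) : (α : Γ) × 𝒱 α :=
  ⟨a.1 + b.1, ⟨𝔤.bracket a.2 b.2, 𝔤.bracket_mem a.2.2 b.2.2⟩⟩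

theorem val_update {Γ k V : Type*} [Field k] [AddCommGroup V] [Module k V]
    {𝒱 : Γ → Submodule k V} {n : ℕ} (e : Fin n → (α : Γ) × 𝒱 α) (j : Fin n) (a : (α : Γ) × 𝒱 α) :
    (fun s => ((Function.update e j a s).2 : V)) =
      Function.update (fun s => ((e s).2 : V)) j (a.2 : V) := by
  funext s
  rcases eq_or_ne s j with rfl | hs
  · rw [Function.update_self, Function.update_self]
  · rw [Function.update_of_ne hs, Function.update_of_ne hs]

namespace EpsLieModule

variable {𝔤 : EpsLieAlgebra ε 𝒱} (𝔐 : EpsLieModule 𝔤 𝒲)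

/-- The coboundary of a multilinear map of degree `β`: on homogeneous `x_s` of degree `α_s`,
`(𝔡f)(x_0, …, x_n)` is the sum over `t` of `(-1)^t` times
`ε(β + α_0 + ⋯ + α_{t-1}, α_t) [x_t, f(x_0, …, x̂_t, …, x_n)]
  - ∑_{j > t} ε(α_t, α_{t+1} + ⋯ + α_{j-1}) f(x_0, …, x̂_t, …, [x_t, x_j], …, x_n)`. -/
noncomputable def coboundMap {n : ℕ} (β : Γ) (f : MultilinearMap k (fun _ : Fin n => V) W) :
    MultilinearMap k (fun _ : Fin (n + 1) => V) W :=
  gradedMultiLift 𝒱 fun α => ∑ t : Fin (n + 1), (-1 : k) ^ (t : ℕ) •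
    (ε (β + ∑ s with s < t, α s) (α t) • insertAct 𝔐.act f t -
      ∑ j : Fin n with t < t.succAbove j,
        ε (α t) (∑ s with t < s ∧ s < t.succAbove j, α s) • insertBracket 𝔤.bracket f t j)

theorem coboundMap_apply {n : ℕ} (β : Γ) (f : MultilinearMap k (fun _ : Fin n => V) W)
    {α : Fin (n + 1) → Γ} {x : Fin (n + 1) → V} (hx : ∀ s, x s ∈ 𝒱 (α s)) :
    𝔐.coboundMap β f x = ∑ t : Fin (n + 1), (-1 : k) ^ (t : ℕ) •
      (ε (β + ∑ s with s < t, α s) (α t) • 𝔐.act (x t) (f (t.removeNth x)) -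
        ∑ j : Fin n with t < t.succAbove j,
          ε (α t) (∑ s with t < s ∧ s < t.succAbove j, α s) •
            f (Function.update (t.removeNth x) j (𝔤.bracket (x t) (x (t.succAbove j))))) := by
  rw [coboundMap, gradedMultiLift_apply 𝒱 _ hx]
  simp only [sum_apply, smul_apply, sub_apply,
    insertAct_apply, insertBracket_apply]

theorem coboundMap_eq_tuple {n : ℕ} (β : Γ) (f : MultilinearMap k (fun _ : Fin n => V) W)
    (e : Fin (n + 1) → (α : Γ) × 𝒱 α) :
    𝔐.coboundMap β f (fun s => (e s).2) = tupleCobound ε Sigma.fst 𝔤.brHom β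
      (fun u y => 𝔐.act u.2 (f fun s => (y s).2)) (fun y => f fun s => (y s).2) e := by
  rw [𝔐.coboundMap_apply β f (fun s => (e s).2.2)]
  simp only [tupleCobound, val_update]
  rfl

theorem coboundMap_mem {n : ℕ} {β : Γ} {f : MultilinearMap k (fun _ : Fin n => V) W}
    (hf : f ∈ cochains ε 𝒱 𝒲 n n β) : 𝔐.coboundMap β f ∈ cochains ε 𝒱 𝒲 (n + 1) (n + 1) β := by
  intro α x hx
  constructor
  · rw [𝔐.coboundMap_apply β f hx]
    refine Submodule.sum_mem _ fun t _ => Submodule.smul_mem _ _ (Submodule.sub_mem _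
      (Submodule.smul_mem _ _ ?_) (Submodule.sum_mem _ fun j _ => Submodule.smul_mem _ _ ?_))
    · have := 𝔐.isModule.act_mem (hx t)
        (hf (t.removeNth α) (t.removeNth x) (fun s => hx _)).1
      convert this using 2
      rw [Fin.sum_univ_succAbove _ t]
      simp only [Fin.removeNth_apply]
      abel
    · refine map_mem_of_update (α := t.removeNth α) hf (fun s => hx _) j
        (𝔤.bracket_mem (hx t) (hx _)) ?_
      rw [Fin.sum_univ_succAbove _ t]
      simp only [Fin.removeNth_apply]
      abel
  · intro p q hpq _
    have hF : TupleSkew ε Sigma.fst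
        (fun y : Fin n → (α : Γ) × 𝒱 α => f fun s => (y s).2) := fun y p q hpq =>
      (hf (fun s => (y s).1) (fun s => (y s).2) (fun s => (y s).2.2)).2 p q hpq q.2
    have key := tupleSkew_tupleCobound (ε := ε) (deg := Sigma.fst) (br := 𝔤.brHom)
      (fun _ _ => rfl) β (P := fun u y => 𝔐.act u.2 (f fun s => (y s).2))
      (F := fun y => f fun s => (y s).2)
      (fun u y p q hpq => by
        have := congrArg (𝔐.act u.2) (hF y p q hpq)
        simpa using this) hF
      (fun y j a b => by
        have hs := eq_neg_of_add_eq_zero_left (𝔤.skew a.2.2 b.2.2)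
        simp only [val_update, EpsLieAlgebra.brHom]
        rw [hs, ← neg_smul, f.map_update_smul, neg_smul])
      (fun s => ⟨α s, x s, hx s⟩) p q hpq
    rw [← 𝔐.coboundMap_eq_tuple, ← 𝔐.coboundMap_eq_tuple] at key
    exact key

/-- The coboundary on cochains of degree `β`. -/
noncomputable def dDeg (n : ℕ) (β : Γ) :
    CochainSpace ε 𝒱 𝒲 n n β →ₗ[k] CochainSpace ε 𝒱 𝒲 (n + 1) (n + 1) β where
  toFun f := .mk (𝔐.coboundMap β f.map) (𝔐.coboundMap_mem f.map_mem)
  map_add' f g := by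
    refine CochainSpace.ext ?_
    refine multilinearMap_ext_of_homogeneous 𝒱 fun α x hx => ?_
    simp only [CochainSpace.map_mk, CochainSpace.map_add, add_apply, 𝔐.coboundMap_apply β _ hx, map_add,
      ← Finset.sum_add_distrib]
    refine Finset.sum_congr rfl fun t _ => ?_
    simp only [smul_add, Finset.sum_add_distrib]
    module
  map_smul' c f := by
    refine CochainSpace.ext ?_
    refine multilinearMap_ext_of_homogeneous 𝒱 fun α x hx => ?_
    simp only [CochainSpace.map_mk, CochainSpace.map_smul, smul_apply, 𝔐.coboundMap_apply β _ hx, map_smul,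
      Finset.smul_sum, RingHom.id_apply]
    refine Finset.sum_congr rfl fun t _ => ?_
    simp only [smul_comm _ c, ← Finset.smul_sum, ← smul_sub]

/-- The action of an element `u` of degree `α` on a multilinear map of degree `β`:
`(ξ(u)f)(x_1, …, x_n) = [u, f(x_1, …, x_n)]
  - ∑_j ε(α, β + α_1 + ⋯ + α_{j-1}) f(x_1, …, [u, x_j], …, x_n)`. -/
noncomputable def actMap {n : ℕ} (α β : Γ) (u : V) (f : MultilinearMap k (fun _ : Fin n => V) W) :
    MultilinearMap k (fun _ : Fin n => V) W :=
  gradedMultiLift 𝒱 fun γ => (𝔐.act u).compMultilinearMap f -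
    ∑ j : Fin n, ε α (β + ∑ s with s < j, γ s) • applyAt (𝔤.bracket u) f j

theorem actMap_apply {n : ℕ} (α β : Γ) (u : V) (f : MultilinearMap k (fun _ : Fin n => V) W)
    {γ : Fin n → Γ} {x : Fin n → V} (hx : ∀ s, x s ∈ 𝒱 (γ s)) :
    𝔐.actMap α β u f x = 𝔐.act u (f x) -
      ∑ j : Fin n, ε α (β + ∑ s with s < j, γ s) •
        f (Function.update x j (𝔤.bracket u (x j))) := by
  rw [actMap, gradedMultiLift_apply 𝒱 _ hx]
  simp only [sum_apply, smul_apply, sub_apply,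
    applyAt_apply, LinearMap.compMultilinearMap_apply]

theorem actMap_mem {n : ℕ} {α β : Γ} {u : V} (hu : u ∈ 𝒱 α)
    {f : MultilinearMap k (fun _ : Fin n => V) W}
    (hf : f ∈ cochains ε 𝒱 𝒲 n n β) : 𝔐.actMap α β u f ∈ cochains ε 𝒱 𝒲 n n (α + β) := by
  intro γ x hx
  constructor
  · rw [𝔐.actMap_apply α β u f hx]
    refine Submodule.sub_mem _ ?_ (Submodule.sum_mem _ fun j _ => Submodule.smul_mem _ _ ?_)
    · have := 𝔐.isModule.act_mem hu (hf γ x hx).1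
      rwa [← add_assoc] at this
    · refine map_mem_of_update hf hx j (𝔤.bracket_mem hu (hx _)) ?_
      abel
  · intro p q hpq _
    have hF : TupleSkew ε Sigma.fst
        (fun y : Fin n → (α : Γ) × 𝒱 α => f fun s => (y s).2) := fun y p q hpq =>
      (hf (fun s => (y s).1) (fun s => (y s).2) (fun s => (y s).2.2)).2 p q hpq q.2
    have eq : ∀ e : Fin n → (α : Γ) × 𝒱 α, 𝔐.actMap α β u f (fun s => (e s).2) =
        𝔐.act u (f fun s => (e s).2) - ε α β • tupleAct ε Sigma.fst 𝔤.brHom ⟨α, u, hu⟩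
          (fun y => f fun s => (y s).2) e := by
      intro e
      rw [𝔐.actMap_apply α β u f (fun s => (e s).2.2)]
      simp only [tupleAct, val_update, ε.add_right, Finset.smul_sum, smul_smul]
      rfl
    have key := tupleSkew_tupleAct (ε := ε) (deg := Sigma.fst) (br := 𝔤.brHom)
      (fun _ _ => rfl) ⟨α, u, hu⟩ hF (fun s => ⟨γ s, x s, hx s⟩) p q hpq
    have h1 := hF (fun s => ⟨γ s, x s, hx s⟩) p q hpq
    have e1 := eq (fun s => ⟨γ s, x s, hx s⟩)
    have e2 := eq ((fun s => ⟨γ s, x s, hx s⟩) ∘ Equiv.swap p q)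
    refine e1.trans ?_
    have h1' := congrArg (𝔐.act u) h1
    have e2' := congrArg (fun w => -(ε (γ p) (γ q) • w)) e2
    refine Eq.trans ?_ e2'.symm
    rw [key]
    rw [map_neg, map_smul] at h1'
    refine (congrArg (· - _) h1').trans ?_
    dsimp only
    simp only [smul_sub, neg_sub, smul_neg, smul_smul, sub_neg_eq_add, mul_comm]
    abel

/-- The action of `𝔤_α` on cochains of degree `β`. -/
noncomputable def actDeg (n : ℕ) (α β : Γ) :
    𝒱 α →ₗ[k] CochainSpace ε 𝒱 𝒲 n n β →ₗ[k] CochainSpace ε 𝒱 𝒲 n n (α + β) :=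
  LinearMap.mk₂ k (fun u f => .mk (𝔐.actMap α β u f.map) (𝔐.actMap_mem u.2 f.map_mem))
    (fun u v f => by
      refine CochainSpace.ext ?_
      refine multilinearMap_ext_of_homogeneous 𝒱 fun γ x hx => ?_
      simp only [CochainSpace.map_mk, CochainSpace.map_add, Submodule.coe_add, add_apply, 𝔐.actMap_apply α β _ _ hx, map_add,
        LinearMap.add_apply, MultilinearMap.map_update_add, smul_add, Finset.sum_add_distrib]
      abel)
    (fun c u f => by
      refine CochainSpace.ext ?_
      refine multilinearMap_ext_of_homogeneous 𝒱 fun γ x hx => ?_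
      simp only [CochainSpace.map_mk, CochainSpace.map_smul, Submodule.coe_smul, smul_apply, 𝔐.actMap_apply α β _ _ hx,
        map_smul, LinearMap.smul_apply, MultilinearMap.map_update_smul, smul_comm _ c,
        ← Finset.smul_sum, ← smul_sub])
    (fun u f g => by
      refine CochainSpace.ext ?_
      refine multilinearMap_ext_of_homogeneous 𝒱 fun γ x hx => ?_
      simp only [CochainSpace.map_mk, CochainSpace.map_add, add_apply, 𝔐.actMap_apply α β _ _ hx, map_add,
        smul_add, Finset.sum_add_distrib]
      abel)
    (fun c u f => by
      refine CochainSpace.ext ?_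
      refine multilinearMap_ext_of_homogeneous 𝒱 fun γ x hx => ?_
      simp only [CochainSpace.map_mk, CochainSpace.map_smul, smul_apply, 𝔐.actMap_apply α β _ _ hx,
        map_smul, smul_comm _ c, ← Finset.smul_sum, ← smul_sub])

/-- `C^n(𝔤, 𝔐) = ⨁_β Hom_β(⋀_ε^n 𝔤, 𝔐)`. -/
abbrev Cochain (_ : EpsLieModule 𝔤 𝒲) (n : ℕ) : Type _ := ⨁ β, CochainSpace ε 𝒱 𝒲 n n β

/-- The grading of `C^n(𝔤, 𝔐)`. -/
abbrev cochainDeg (n : ℕ) : Γ → Submodule k (𝔐.Cochain n) :=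
  totalDeg k (fun β => CochainSpace ε 𝒱 𝒲 n n β)

/-- The coboundary operator `𝔡 : C^n(𝔤, 𝔐) → C^{n+1}(𝔤, 𝔐)`. -/
noncomputable def d (n : ℕ) : 𝔐.Cochain n →ₗ[k] 𝔐.Cochain (n + 1) :=
  DirectSum.lmap fun β => 𝔐.dDeg n β

/-- The representation `ξ` of `𝔤` on `C^n(𝔤, 𝔐)`. -/
noncomputable def cochainAct (n : ℕ) : V →ₗ[k] 𝔐.Cochain n →ₗ[k] 𝔐.Cochain n :=
  totalAct 𝒱 fun α β => 𝔐.actDeg n α β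

/-- `Z^n(𝔤, 𝔐)`. -/
noncomputable def cocycles (n : ℕ) : Submodule k (𝔐.Cochain n) := LinearMap.ker (𝔐.d n)

/-- `B^n(𝔤, 𝔐)`. -/
noncomputable def coboundaries : (n : ℕ) → Submodule k (𝔐.Cochain n)
  | 0 => ⊥
  | n + 1 => LinearMap.range (𝔐.d n)

/-- `H^n_Lie(𝔤, 𝔐) = Z^n / B^n`. -/
abbrev Cohomology (n : ℕ) : Type _ :=
  𝔐.cocycles n ⧸ (𝔐.coboundaries n).submoduleOf (𝔐.cocycles n)

end EpsLieModule

end Lie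

section LeftSymmetric

variable {Γ k : Type*} [AddCommGroup Γ] [Field k] {ε : CommutationFactor Γ k}
variable {S M : Type*} [AddCommGroup S] [Module k S] [AddCommGroup M] [Module k M]
variable {𝒮 : Γ → Submodule k S} {ℳ : Γ → Submodule k M}

theorem comp_swap_castSucc {i : ℕ} {E : Type*} (x : Fin (i + 1) → E) (p q : Fin i) :
    x ∘ Equiv.swap p.castSucc q.castSucc =
      Fin.snoc (α := fun _ => E) (fun s => x (Equiv.swap p q s).castSucc) (x (Fin.last i)) := by
  funext s
  cases s using Fin.lastCases with
  | last => simp [Equiv.swap_apply_of_ne_of_ne (Fin.castSucc_lt_last p).ne'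
      (Fin.castSucc_lt_last q).ne']
  | cast s =>
    rw [Fin.snoc_castSucc, Function.comp_apply]
    congr 1
    simp only [Equiv.swap_apply_def, Fin.castSucc_inj]
    split_ifs <;> rfl

theorem tupleSkew_of_mem {i : ℕ} {β : Γ} {f : MultilinearMap k (fun _ : Fin (i + 1) => S) M}
    (hf : f ∈ cochains ε 𝒮 ℳ (i + 1) i β) (z : (α : Γ) × 𝒮 α) :
    TupleSkew ε Sigma.fst (fun y : Fin i → (α : Γ) × 𝒮 α =>
      f (Fin.snoc (α := fun _ => S) (fun s => ((y s).2 : S)) z.2)) := by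
  intro y p q hpq
  have hx : ∀ s, (Fin.snoc (α := fun _ => S) (fun s => ((y s).2 : S)) z.2 : Fin (i + 1) → S) s ∈
      𝒮 ((Fin.snoc (α := fun _ => Γ) (fun s => (y s).1) z.1 : Fin (i + 1) → Γ) s) := by
    intro s
    cases s using Fin.lastCases with
    | last => simp only [Fin.snoc_last]; exact z.2.2
    | cast s => simp only [Fin.snoc_castSucc]; exact (y s).2.2
  have h := (hf _ _ hx).2 p.castSucc q.castSucc hpq q.2
  rw [comp_swap_castSucc] at h
  simp only [Fin.snoc_castSucc, Fin.snoc_last] at h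
  exact h

theorem skew_of_tupleSkew {i : ℕ} {f : MultilinearMap k (fun _ : Fin (i + 1) => S) M}
    (h : ∀ z : (α : Γ) × 𝒮 α, TupleSkew ε Sigma.fst (fun y : Fin i → (α : Γ) × 𝒮 α =>
      f (Fin.snoc (α := fun _ => S) (fun s => ((y s).2 : S)) z.2)))
    {α : Fin (i + 1) → Γ} {x : Fin (i + 1) → S} (hx : ∀ s, x s ∈ 𝒮 (α s))
    {p q : Fin (i + 1)} (hpq : (p : ℕ) + 1 = q) (hq : (q : ℕ) < i) :
    f x = -(ε (α p) (α q) • f (x ∘ Equiv.swap p q)) := by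
  obtain ⟨p, rfl⟩ : ∃ p' : Fin i, p = p'.castSucc := ⟨⟨p, by omega⟩, rfl⟩
  obtain ⟨q, rfl⟩ : ∃ q' : Fin i, q = q'.castSucc := ⟨⟨q, by omega⟩, rfl⟩
  have key := h ⟨α (Fin.last i), x (Fin.last i), hx _⟩
    (fun s => ⟨α s.castSucc, x s.castSucc, hx _⟩) p q hpq
  rw [comp_swap_castSucc]
  have e : Fin.snoc (α := fun _ => S) (fun s : Fin i => x s.castSucc) (x (Fin.last i)) = x :=
    Fin.snoc_init_self x
  have key' := key
  simp only [e] at key'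
  exact key'

variable [DecidableEq Γ] [DirectSum.Decomposition 𝒮]

namespace Bimodule

variable {A : LeftSymmetricAlgebra ε 𝒮} (B : Bimodule A ℳ)

/-- The coboundary of a multilinear map of degree `β` in the variables `x_0, …, x_{i-1}, x_i`
(the last one is distinguished): on homogeneous `x_s` of degree `α_s`,
`(df)(x_0, …, x_i, x_{i+1})` is the sum over `t ≤ i` of `(-1)^t` times
`ε(β + α_0 + ⋯ + α_{t-1}, α_t) x_t · f(x_0, …, x̂_t, …, x_i, x_{i+1})
  - ε(α_t, α_{t+1} + ⋯ + α_i) f(x_0, …, x̂_t, …, x_i, x_t · x_{i+1})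
  + ε(α_t, α_{t+1} + ⋯ + α_i) f(x_0, …, x̂_t, …, x_i, x_t) · x_{i+1}
  - ∑_{t < j ≤ i} ε(α_t, α_{t+1} + ⋯ + α_{j-1}) f(x_0, …, x̂_t, …, [x_t, x_j], …, x_i, x_{i+1})`. -/
noncomputable def coboundMap {i : ℕ} (β : Γ)
    (f : MultilinearMap k (fun _ : Fin (i + 1) => S) M) :
    MultilinearMap k (fun _ : Fin (i + 1 + 1) => S) M :=
  gradedMultiLift 𝒮 fun α => ∑ t : Fin (i + 1), (-1 : k) ^ (t : ℕ) •
    (ε (β + ∑ s with s < t.castSucc, α s) (α t.castSucc) • insertAct B.left f t.castSucc -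
      ε (α t.castSucc) (∑ s with t.castSucc < s ∧ s < Fin.last (i + 1), α s) •
        insertBracket A.mul f t.castSucc (Fin.last i) +
      ε (α t.castSucc) (∑ s with t.castSucc < s ∧ s < Fin.last (i + 1), α s) •
        insertRight B.right f t.castSucc (Fin.last i) -
      ∑ j : Fin i with t < t.succAbove j,
        ε (α t.castSucc)
            (∑ s with t.castSucc < s ∧ s < (t.succAbove j).castSucc, α s) •
          insertBracket A.lie.bracket f t.castSucc j.castSucc)

theorem coboundMap_apply {i : ℕ} (β : Γ) (f : MultilinearMap k (fun _ : Fin (i + 1) => S) M)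
    {α : Fin (i + 1 + 1) → Γ} {x : Fin (i + 1 + 1) → S} (hx : ∀ s, x s ∈ 𝒮 (α s)) :
    B.coboundMap β f x = ∑ t : Fin (i + 1), (-1 : k) ^ (t : ℕ) •
    (ε (β + ∑ s with s < t.castSucc, α s) (α t.castSucc) •
        B.left (x t.castSucc) (f (t.castSucc.removeNth x)) -
      ε (α t.castSucc) (∑ s with t.castSucc < s ∧ s < Fin.last (i + 1), α s) •
        f (Function.update (t.castSucc.removeNth x) (Fin.last i)
          (A.mul (x t.castSucc) (x (Fin.last (i + 1))))) +
      ε (α t.castSucc) (∑ s with t.castSucc < s ∧ s < Fin.last (i + 1), α s) •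
        B.right (f (Function.update (t.castSucc.removeNth x) (Fin.last i) (x t.castSucc)))
          (x (Fin.last (i + 1))) -
      ∑ j : Fin i with t < t.succAbove j,
        ε (α t.castSucc)
            (∑ s with t.castSucc < s ∧ s < (t.succAbove j).castSucc, α s) •
          f (Function.update (t.castSucc.removeNth x) j.castSucc
            (A.lie.bracket (x t.castSucc) (x (t.succAbove j).castSucc)))) := by
  rw [coboundMap, gradedMultiLift_apply 𝒮 _ hx]
  have hl : ∀ t : Fin (i + 1), t.castSucc.succAbove (Fin.last i) = Fin.last (i + 1) :=
    fun t => by simp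
  simp only [sum_apply, smul_apply, sub_apply, add_apply,
    insertAct_apply, insertBracket_apply, insertRight_apply, hl, Fin.castSucc_succAbove_castSucc]

theorem coboundMap_eq_tuple {i : ℕ} (β : Γ) (f : MultilinearMap k (fun _ : Fin (i + 1) => S) M)
    (z : (α : Γ) × 𝒮 α) (e : Fin (i + 1) → (α : Γ) × 𝒮 α) :
    B.coboundMap β f (Fin.snoc (α := fun _ => S) (fun s => ((e s).2 : S)) z.2) =
      tupleCobound ε Sigma.fst A.lie.brHom β
      (fun u y =>
        B.left u.2 (f (Fin.snoc (α := fun _ => S) (fun s => ((y s).2 : S)) z.2)) -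
        ε u.1 (β + ∑ s, (y s).1) •
          (f (Fin.snoc (α := fun _ => S) (fun s => ((y s).2 : S)) (A.mul u.2 z.2)) -
          B.right (f (Fin.snoc (α := fun _ => S) (fun s => ((y s).2 : S)) u.2)) z.2))
      (fun y => f (Fin.snoc (α := fun _ => S) (fun s => ((y s).2 : S)) z.2)) e := by
  have hx : ∀ s, (Fin.snoc (α := fun _ => S) (fun s => ((e s).2 : S)) z.2 : Fin (i + 2) → S) s ∈
      𝒮 ((Fin.snoc (α := fun _ => Γ) (fun s => (e s).1) z.1 : Fin (i + 2) → Γ) s) := by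
    intro s
    cases s using Fin.lastCases with
    | last => simp only [Fin.snoc_last]; exact z.2.2
    | cast s => simp only [Fin.snoc_castSucc]; exact (e s).2.2
  rw [B.coboundMap_apply β f hx, tupleCobound]
  refine Finset.sum_congr rfl fun t _ => ?_
  have hr : t.castSucc.removeNth (Fin.snoc (α := fun _ => S) (fun s => ((e s).2 : S)) z.2 :
      Fin (i + 2) → S) = Fin.snoc (α := fun _ => S) (fun s => ((t.removeNth e s).2 : S)) z.2 := by
    funext s
    cases s using Fin.lastCases with
    | last => simp [Fin.removeNth]
    | cast s => simp [Fin.removeNth]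
  have s1 : (∑ s with s < t.castSucc, (Fin.snoc (α := fun _ => Γ) (fun s => (e s).1) z.1 :
      Fin (i + 2) → Γ) s) = ∑ s with s < t, (e s).1 := by
    rw [Finset.sum_filter, Fin.sum_univ_castSucc, Finset.sum_filter]
    simp [Fin.not_lt.2 (Fin.le_last _)]
  have s2 : (∑ s with t.castSucc < s ∧ s < Fin.last (i + 1),
      (Fin.snoc (α := fun _ => Γ) (fun s => (e s).1) z.1 : Fin (i + 2) → Γ) s) =
        ∑ s with t < s, (e s).1 := by
    rw [Finset.sum_filter, Fin.sum_univ_castSucc, Finset.sum_filter]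
    simp [Fin.castSucc_lt_last]
  have s3 : ∀ j : Fin i, (∑ s with t.castSucc < s ∧ s < (t.succAbove j).castSucc,
      (Fin.snoc (α := fun _ => Γ) (fun s => (e s).1) z.1 : Fin (i + 2) → Γ) s) =
        ∑ s with t < s ∧ s < t.succAbove j, (e s).1 := by
    intro j
    rw [Finset.sum_filter, Fin.sum_univ_castSucc, Finset.sum_filter]
    simp [Fin.not_lt.2 (Fin.le_last _)]
  have s4 : (∑ s, (t.removeNth e s).1) = (∑ s with s < t, (e s).1) + ∑ s with t < s, (e s).1 := by
    have h := Fin.sum_univ_succAbove (fun s => (e s).1) t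
    have h' : (∑ s, (e s).1) =
        (e t).1 + ((∑ s with s < t, (e s).1) + ∑ s with t < s, (e s).1) := by
      have h1 : ∀ s, (e s).1 = (if s = t then (e s).1 else 0) +
          ((if s < t then (e s).1 else 0) + if t < s then (e s).1 else 0) := by
        intro s
        rcases lt_trichotomy s t with h | h | h
        · simp [h, h.ne, h.not_gt]
        · simp [h]
        · simp [h, h.ne', h.not_gt]
      rw [Finset.sum_congr rfl fun s _ => h1 s, Finset.sum_add_distrib, Finset.sum_add_distrib]
      simp [Finset.sum_filter]
    exact add_left_cancel (h.symm.trans h')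
  simp only [hr, s1, s2, s3]
  simp only [Fin.snoc_castSucc, Fin.snoc_last, s4, Fin.update_snoc_last, ← Fin.snoc_update,
    val_update]
  have h1 := ε.mul_swap (∑ s with s < t, (e s).1) (e t).1
  have h2 := ε.mul_swap β (e t).1
  simp only [ε.add_left, ε.add_right, EpsLieAlgebra.brHom]
  congr 2
  match_scalars <;> grind

theorem coboundMap_mem {i : ℕ} {β : Γ} {f : MultilinearMap k (fun _ : Fin (i + 1) => S) M}
    (hf : f ∈ cochains ε 𝒮 ℳ (i + 1) i β) :
    B.coboundMap β f ∈ cochains ε 𝒮 ℳ (i + 1 + 1) (i + 1) β := by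
  intro α x hx
  constructor
  · rw [B.coboundMap_apply β f hx]
    have hx' : ∀ (t : Fin (i + 1)) s, t.castSucc.removeNth x s ∈ 𝒮 (t.castSucc.removeNth α s) :=
      fun t s => hx _
    have hs : ∀ t : Fin (i + 1), ∑ s, α s = α t.castSucc + ∑ s, t.castSucc.removeNth α s :=
      fun t => Fin.sum_univ_succAbove α t.castSucc
    have hl : ∀ t : Fin (i + 1), t.castSucc.removeNth α (Fin.last i) = α (Fin.last (i + 1)) :=
      fun t => by simp [Fin.removeNth_apply]
    have hj : ∀ (t : Fin (i + 1)) (j : Fin i),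
        t.castSucc.removeNth α j.castSucc = α (t.succAbove j).castSucc :=
      fun t j => by simp [Fin.removeNth_apply]
    refine Submodule.sum_mem _ fun t _ => Submodule.smul_mem _ _ (Submodule.sub_mem _
      (Submodule.add_mem _ (Submodule.sub_mem _ (Submodule.smul_mem _ _ ?_)
      (Submodule.smul_mem _ _ ?_)) (Submodule.smul_mem _ _ ?_))
      (Submodule.sum_mem _ fun j _ => Submodule.smul_mem _ _ ?_))
    · have := B.left_mem (hx t.castSucc) (hf _ _ (hx' t)).1
      convert this using 2
      rw [hs t]
      abel
    · refine map_mem_of_update hf (hx' t) _ (A.mul_mem (hx _) (hx _)) ?_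
      rw [hs t, hl]
      abel
    · have := B.right_mem (map_mem_of_update hf (hx' t) (Fin.last i) (hx t.castSucc)
        (μ := β + ∑ s, α s - α (Fin.last (i + 1))) (by rw [hs t, hl]; abel))
        (hx (Fin.last (i + 1)))
      rwa [sub_add_cancel] at this
    · refine map_mem_of_update hf (hx' t) _ (A.lie.bracket_mem (hx _) (hx _)) ?_
      rw [hs t, hj]
      abel
  · intro p q hpq hq
    refine skew_of_tupleSkew (fun z => ?_) hx hpq hq
    simp only [B.coboundMap_eq_tuple]
    refine tupleSkew_tupleCobound (fun _ _ => rfl) β (fun u y p q hpq => ?_)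
      (tupleSkew_of_mem hf z) (fun y j a b => ?_)
    · have h1 := tupleSkew_of_mem hf z y p q hpq
      have h2 := tupleSkew_of_mem hf ⟨_, _, A.mul_mem u.2.2 z.2.2⟩ y p q hpq
      have h3 := tupleSkew_of_mem hf u y p q hpq
      have h4 : (∑ s, ((y ∘ Equiv.swap p q) s).1) = ∑ s, (y s).1 :=
        Equiv.sum_comp (Equiv.swap p q) (fun s => (y s).1)
      dsimp only at h1 h2 h3 ⊢
      rw [h1, h2, h3, h4]
      simp only [map_neg, map_smul, LinearMap.neg_apply, LinearMap.smul_apply]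
      module
    · have hs := eq_neg_of_add_eq_zero_left (A.lie.skew a.2.2 b.2.2)
      simp only [val_update, EpsLieAlgebra.brHom, Fin.snoc_update]
      rw [hs, ← neg_smul, f.map_update_smul, neg_smul]

/-- The coboundary on cochains of degree `β`. -/
noncomputable def dDeg (i : ℕ) (β : Γ) :
    CochainSpace ε 𝒮 ℳ (i + 1) i β →ₗ[k] CochainSpace ε 𝒮 ℳ (i + 1 + 1) (i + 1) β where
  toFun f := .mk (B.coboundMap β f.map) (B.coboundMap_mem f.map_mem)
  map_add' f g := by
    refine CochainSpace.ext (multilinearMap_ext_of_homogeneous 𝒮 fun α x hx => ?_)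
    simp only [CochainSpace.map_mk, CochainSpace.map_add, add_apply,
      B.coboundMap_apply β _ hx, map_add, LinearMap.add_apply, ← Finset.sum_add_distrib]
    refine Finset.sum_congr rfl fun t _ => ?_
    simp only [smul_add, Finset.sum_add_distrib]
    module
  map_smul' c f := by
    refine CochainSpace.ext (multilinearMap_ext_of_homogeneous 𝒮 fun α x hx => ?_)
    simp only [CochainSpace.map_mk, CochainSpace.map_smul, smul_apply,
      B.coboundMap_apply β _ hx, map_smul, LinearMap.smul_apply, Finset.smul_sum,
      RingHom.id_apply]
    refine Finset.sum_congr rfl fun t _ => ?_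
    simp only [smul_comm _ c, ← Finset.smul_sum, ← smul_sub, ← smul_add]

/-- The action of an element `u` of degree `α` on a multilinear map of degree `β` in the
variables `x_1, …, x_i, x_{i+1}`:
`(ρ(u)f)(x_1, …, x_i, x_{i+1}) = u · f(x_1, …, x_i, x_{i+1})
  - ε(α, β + α_1 + ⋯ + α_i) f(x_1, …, x_i, u · x_{i+1})
  + ε(α, β + α_1 + ⋯ + α_i) f(x_1, …, x_i, u) · x_{i+1}
  - ∑_{j ≤ i} ε(α, β + α_1 + ⋯ + α_{j-1}) f(x_1, …, [u, x_j], …, x_i, x_{i+1})`. -/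
noncomputable def actMap {i : ℕ} (α β : Γ) (u : S)
    (f : MultilinearMap k (fun _ : Fin (i + 1) => S) M) :
    MultilinearMap k (fun _ : Fin (i + 1) => S) M :=
  gradedMultiLift 𝒮 fun γ => (B.left u).compMultilinearMap f -
    ε α (β + ∑ s with s < Fin.last i, γ s) • applyAt (A.mul u) f (Fin.last i) +
    ε α (β + ∑ s with s < Fin.last i, γ s) • replaceAt B.right u f (Fin.last i) -
    ∑ j : Fin i, ε α (β + ∑ s with s < j.castSucc, γ s) •
      applyAt (A.lie.bracket u) f j.castSucc

theorem actMap_apply {i : ℕ} (α β : Γ) (u : S)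
    (f : MultilinearMap k (fun _ : Fin (i + 1) => S) M)
    {γ : Fin (i + 1) → Γ} {x : Fin (i + 1) → S} (hx : ∀ s, x s ∈ 𝒮 (γ s)) :
    B.actMap α β u f x = B.left u (f x) -
      ε α (β + ∑ s with s < Fin.last i, γ s) •
        f (Function.update x (Fin.last i) (A.mul u (x (Fin.last i)))) +
      ε α (β + ∑ s with s < Fin.last i, γ s) •
        B.right (f (Function.update x (Fin.last i) u)) (x (Fin.last i)) -
      ∑ j : Fin i, ε α (β + ∑ s with s < j.castSucc, γ s) •
        f (Function.update x j.castSucc (A.lie.bracket u (x j.castSucc))) := by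
  rw [actMap, gradedMultiLift_apply 𝒮 _ hx]
  simp only [sum_apply, smul_apply, sub_apply, add_apply,
    applyAt_apply, replaceAt_apply, LinearMap.compMultilinearMap_apply]

theorem actMap_mem {i : ℕ} {α β : Γ} {u : S} (hu : u ∈ 𝒮 α)
    {f : MultilinearMap k (fun _ : Fin (i + 1) => S) M}
    (hf : f ∈ cochains ε 𝒮 ℳ (i + 1) i β) :
    B.actMap α β u f ∈ cochains ε 𝒮 ℳ (i + 1) i (α + β) := by
  intro γ x hx
  constructor
  · rw [B.actMap_apply α β u f hx]
    refine Submodule.sub_mem _ (Submodule.add_mem _ (Submodule.sub_mem _ ?_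
      (Submodule.smul_mem _ _ ?_)) (Submodule.smul_mem _ _ ?_))
      (Submodule.sum_mem _ fun j _ => Submodule.smul_mem _ _ ?_)
    · have := B.left_mem hu (hf γ x hx).1
      rwa [← add_assoc] at this
    · refine map_mem_of_update hf hx _ (A.mul_mem hu (hx _)) ?_
      abel
    · have := B.right_mem (map_mem_of_update hf hx (Fin.last i) hu
        (μ := α + β + ∑ s, γ s - γ (Fin.last i)) (by abel)) (hx (Fin.last i))
      rwa [sub_add_cancel] at this
    · refine map_mem_of_update hf hx _ (A.lie.bracket_mem hu (hx _)) ?_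
      abel
  · intro p q hpq hq
    refine skew_of_tupleSkew (fun z => ?_) hx hpq hq
    have eq : ∀ e : Fin i → (α : Γ) × 𝒮 α,
        B.actMap α β u f (Fin.snoc (α := fun _ => S) (fun s => ((e s).2 : S)) z.2) =
        B.left u (f (Fin.snoc (α := fun _ => S) (fun s => ((e s).2 : S)) z.2)) -
        ε α (β + ∑ s, (e s).1) •
          (f (Fin.snoc (α := fun _ => S) (fun s => ((e s).2 : S)) (A.mul u z.2)) -
          B.right (f (Fin.snoc (α := fun _ => S) (fun s => ((e s).2 : S)) u)) z.2) -
        ε α β • tupleAct ε Sigma.fst A.lie.brHom ⟨α, u, hu⟩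
          (fun y => f (Fin.snoc (α := fun _ => S) (fun s => ((y s).2 : S)) z.2)) e := by
      intro e
      have hx : ∀ s, (Fin.snoc (α := fun _ => S) (fun s => ((e s).2 : S)) z.2 :
          Fin (i + 1) → S) s ∈
          𝒮 ((Fin.snoc (α := fun _ => Γ) (fun s => (e s).1) z.1 : Fin (i + 1) → Γ) s) := by
        intro s
        cases s using Fin.lastCases with
        | last => simp only [Fin.snoc_last]; exact z.2.2
        | cast s => simp only [Fin.snoc_castSucc]; exact (e s).2.2
      rw [B.actMap_apply α β u f hx]
      have s1 : ∀ t : Fin i, (∑ s with s < t.castSucc, (Fin.snoc (α := fun _ => Γ)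
          (fun s => (e s).1) z.1 : Fin (i + 1) → Γ) s) = ∑ s with s < t, (e s).1 := by
        intro t
        rw [Finset.sum_filter, Fin.sum_univ_castSucc, Finset.sum_filter]
        simp [Fin.not_lt.2 (Fin.le_last _)]
      have s2 : (∑ s with s < Fin.last i, (Fin.snoc (α := fun _ => Γ)
          (fun s => (e s).1) z.1 : Fin (i + 1) → Γ) s) = ∑ s, (e s).1 := by
        rw [Finset.sum_filter, Fin.sum_univ_castSucc]
        simp [Fin.castSucc_lt_last]
      simp only [s1, s2, tupleAct, val_update, ε.add_right, Finset.smul_sum, smul_smul,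
        Fin.snoc_castSucc, Fin.snoc_last, Fin.update_snoc_last, ← Fin.snoc_update,
        EpsLieAlgebra.brHom]
      module
    intro y p q hpq
    have h0 := tupleSkew_tupleAct (ε := ε) (deg := Sigma.fst) (br := A.lie.brHom)
      (fun _ _ => rfl) ⟨α, u, hu⟩ (tupleSkew_of_mem hf z) y p q hpq
    have h1 := tupleSkew_of_mem hf z y p q hpq
    have h2 := tupleSkew_of_mem hf ⟨_, _, A.mul_mem hu z.2.2⟩ y p q hpq
    have h3 := tupleSkew_of_mem hf ⟨α, u, hu⟩ y p q hpq
    have h4 : (∑ s, ((y ∘ Equiv.swap p q) s).1) = ∑ s, (y s).1 :=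
      Equiv.sum_comp (Equiv.swap p q) (fun s => (y s).1)
    simp only [eq]
    dsimp only at h1 h2 h3
    rw [h0, h1, h2, h3, h4]
    simp only [map_neg, map_smul, LinearMap.neg_apply, LinearMap.smul_apply]
    module

/-- The action of `S_α` on cochains of degree `β`. -/
noncomputable def actDeg (i : ℕ) (α β : Γ) :
    𝒮 α →ₗ[k] CochainSpace ε 𝒮 ℳ (i + 1) i β →ₗ[k] CochainSpace ε 𝒮 ℳ (i + 1) i (α + β) :=
  LinearMap.mk₂ k (fun u f => .mk (B.actMap α β u f.map) (B.actMap_mem u.2 f.map_mem))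
    (fun u v f => by
      refine CochainSpace.ext (multilinearMap_ext_of_homogeneous 𝒮 fun γ x hx => ?_)
      simp only [CochainSpace.map_mk, CochainSpace.map_add, Submodule.coe_add, add_apply,
        B.actMap_apply α β _ _ hx, map_add, LinearMap.add_apply, MultilinearMap.map_update_add,
        smul_add, Finset.sum_add_distrib]
      abel)
    (fun c u f => by
      refine CochainSpace.ext (multilinearMap_ext_of_homogeneous 𝒮 fun γ x hx => ?_)
      simp only [CochainSpace.map_mk, CochainSpace.map_smul, Submodule.coe_smul, smul_apply,
        B.actMap_apply α β _ _ hx, map_smul, LinearMap.smul_apply,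
        MultilinearMap.map_update_smul, smul_comm _ c, ← Finset.smul_sum, ← smul_sub, ← smul_add])
    (fun u f g => by
      refine CochainSpace.ext (multilinearMap_ext_of_homogeneous 𝒮 fun γ x hx => ?_)
      simp only [CochainSpace.map_mk, CochainSpace.map_add, add_apply,
        B.actMap_apply α β _ _ hx, map_add, LinearMap.add_apply, smul_add,
        Finset.sum_add_distrib]
      abel)
    (fun c u f => by
      refine CochainSpace.ext (multilinearMap_ext_of_homogeneous 𝒮 fun γ x hx => ?_)
      simp only [CochainSpace.map_mk, CochainSpace.map_smul, smul_apply,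
        B.actMap_apply α β _ _ hx, map_smul, LinearMap.smul_apply, smul_comm _ c,
        ← Finset.smul_sum, ← smul_sub, ← smul_add])

/-- `C^{i+1}(S, M) = ⨁_β Hom_β(⋀_ε^i S ⊗ S, M)`. -/
abbrev Cochain (_ : Bimodule A ℳ) (i : ℕ) : Type _ := ⨁ β, CochainSpace ε 𝒮 ℳ (i + 1) i β

/-- The grading of `C^{i+1}(S, M)`. -/
abbrev cochainDeg (i : ℕ) : Γ → Submodule k (B.Cochain i) :=
  totalDeg k (fun β => CochainSpace ε 𝒮 ℳ (i + 1) i β)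

/-- The coboundary operator `d : C^{i+1}(S, M) → C^{i+2}(S, M)`. -/
noncomputable def d (i : ℕ) : B.Cochain i →ₗ[k] B.Cochain (i + 1) :=
  DirectSum.lmap fun β => B.dDeg i β

/-- The representation `ρ` of `𝔤_S` on `C^{i+1}(S, M)`. -/
noncomputable def cochainAct (i : ℕ) : S →ₗ[k] B.Cochain i →ₗ[k] B.Cochain i :=
  totalAct 𝒮 fun α β => B.actDeg i α β

/-- `C⁰(S, M) ∩ M_β`, where `C⁰(S, M) = {m ∈ M | (a · b) · m = a · (b · m) for all a, b ∈ S}`. -/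
def zeroCochains (β : Γ) : Submodule k M where
  carrier := {m | m ∈ ℳ β ∧ ∀ a b : S, B.left (A.mul a b) m = B.left a (B.left b m)}
  add_mem' hm hn := ⟨Submodule.add_mem _ hm.1 hn.1, fun a b => by
    simp only [map_add, hm.2 a b, hn.2 a b]⟩
  zero_mem' := ⟨Submodule.zero_mem _, fun a b => by simp⟩
  smul_mem' c m hm := ⟨Submodule.smul_mem _ c hm.1, fun a b => by simp only [map_smul, hm.2 a b]⟩

/-- The coboundary of `m ∈ C⁰(S, M) ∩ M_β`: `(dm)(x) = ε(β, α) x · m - m · x` for `x ∈ S_α`. -/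
noncomputable def dZeroMap (β : Γ) (m : M) : MultilinearMap k (fun _ : Fin (0 + 1) => S) M :=
  LinearMap.compMultilinearMap (gradedLift 𝒮 fun α => ε β α • B.left.flip m - B.right m)
    (MultilinearMap.ofSubsingleton k S S (0 : Fin 1) LinearMap.id)

theorem dZeroMap_apply (β : Γ) (m : M) {α : Γ} {x : Fin (0 + 1) → S} (hx : x 0 ∈ 𝒮 α) :
    B.dZeroMap β m x = ε β α • B.left (x 0) m - B.right m (x 0) := by
  have h : B.dZeroMap β m x =
      gradedLift 𝒮 (fun α => ε β α • B.left.flip m - B.right m) (x 0) := rfl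
  rw [h, gradedLift_apply 𝒮 _ hx]
  simp

/-- The coboundary operator on `C⁰(S, M) ∩ M_β`. -/
noncomputable def dZeroDeg (β : Γ) : B.zeroCochains β →ₗ[k] CochainSpace ε 𝒮 ℳ (0 + 1) 0 β where
  toFun m := .mk (B.dZeroMap β m) (by
    intro α x hx
    refine ⟨?_, fun p q _ hq => by omega⟩
    rw [B.dZeroMap_apply β _ (hx 0)]
    refine Submodule.sub_mem _ (Submodule.smul_mem _ _ ?_) ?_
    · have := B.left_mem (hx 0) m.2.1
      simpa [add_comm] using this
    · have := B.right_mem m.2.1 (hx 0)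
      simpa using this)
  map_add' m m' := by
    refine CochainSpace.ext (multilinearMap_ext_of_homogeneous 𝒮 fun γ x hx => ?_)
    change B.dZeroMap β (m + m' : M) x = B.dZeroMap β m x + B.dZeroMap β m' x
    simp only [B.dZeroMap_apply β _ (hx 0), map_add, LinearMap.add_apply]
    module
  map_smul' c m := by
    refine CochainSpace.ext (multilinearMap_ext_of_homogeneous 𝒮 fun γ x hx => ?_)
    change B.dZeroMap β (c • m : M) x = c • B.dZeroMap β m x
    simp only [B.dZeroMap_apply β _ (hx 0), map_smul, LinearMap.smul_apply]
    module

/-- The coboundary operator `d : C⁰(S, M) → C¹(S, M)`. -/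
noncomputable def dZero : (⨁ β, B.zeroCochains β) →ₗ[k] B.Cochain 0 :=
  DirectSum.lmap fun β => B.dZeroDeg β

/-- `Z^{i+1}(S, M)`. -/
noncomputable def cocycles (i : ℕ) : Submodule k (B.Cochain i) := LinearMap.ker (B.d i)

/-- `B^{i+1}(S, M)`. -/
noncomputable def coboundaries : (i : ℕ) → Submodule k (B.Cochain i)
  | 0 => LinearMap.range B.dZero
  | i + 1 => LinearMap.range (B.d i)

/-- `H^{i+1}(S, M) = Z^{i+1} / B^{i+1}`. -/
abbrev Cohomology (i : ℕ) : Type _ :=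
  B.cocycles i ⧸ (B.coboundaries i).submoduleOf (B.cocycles i)

section Psi

variable [DirectSum.Decomposition ℳ] [FiniteDimensional k S] [FiniteDimensional k M]

/-- `ψ` on cochains of degree `β`:
`ψ(f)(x_1, …, x_i, x_{i+1}) = f(x_1, …, x_i)(x_{i+1})`. -/
noncomputable def psiDeg (i : ℕ) (β : Γ) :
    CochainSpace ε 𝒮 (homDeg 𝒮 ℳ) i i β →ₗ[k] CochainSpace ε 𝒮 ℳ (i + 1) i β where
  toFun f := .mk (MultilinearMap.uncurryRight (M := fun _ : Fin (i + 1) => S) f.map) (by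
    intro α x hx
    constructor
    · have := ((f.map_mem (Fin.init α) (Fin.init x) (fun s => hx _)).1) _ _ (hx (Fin.last i))
      rw [Fin.sum_univ_castSucc, ← add_assoc]
      exact this
    · intro p q hpq hq
      refine skew_of_tupleSkew (fun z y p q hpq => ?_) hx hpq hq
      have := (f.map_mem (fun s => (y s).1) (fun s => (y s).2) (fun s => (y s).2.2)).2 p q hpq q.2
      have h := congrArg (fun g : S →ₗ[k] M => g z.2) this
      simp only [MultilinearMap.uncurryRight_apply, Fin.init_snoc, Fin.snoc_last]
      exact h)
  map_add' f g := rfl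
  map_smul' c f := rfl

/-- `ψ : C^i(𝔤_S, C¹(S, M)) → C^{i+1}(S, M)`. -/
noncomputable def psi (i : ℕ) : B.homModule.Cochain i →ₗ[k] B.Cochain i :=
  DirectSum.lmap fun β => psiDeg (ε := ε) (𝒮 := 𝒮) (ℳ := ℳ) i β

end Psi

end Bimodule

end LeftSymmetric

end GLSA

/-! The map ψ only uncurries the last argument, so it is bijective in each degree. Finite dimension
makes Hom(S, M) the direct sum of its homogeneous parts, which is why all of Hom(S, M) serves as
graded coefficients. Evaluating the action of x on a homogeneous f(x_1, …, x_i) at x_{i+1} produces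
exactly the three terms of ρ and d that involve the last argument, with the sign ε(α, β + α_1 + ⋯ +
α_i) because f(x_1, …, x_i) has degree β + α_1 + ⋯ + α_i. The bracket terms on the first i arguments
agree on both sides. Hence ψ intertwines ξ with ρ and 𝔡 with d (`uncurryRight_actMap`,
`uncurryRight_coboundMap`).

It remains to prove the module law and 𝔡² = 0 on the ε-Lie side; bijectivity of ψ then carries both
to C(S, M), and cohomology follows. This is Cartan calculus. Let ι_a insert a in the first slot and
L_a be the Lie derivative. For F of degree β, ι_a L_u = L_u ι_a - ε(u, β) ι_[u,a] and ι_a d = ε(β,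
a) L_a - d ι_a. Since F is determined by all ι_a F, induction on the number of arguments gives, in
order, L_[a,b] = L_a L_b - ε(a, b) L_b L_a (`tupleLie_bracket`), L_a d = d L_a (`tupleLie_tupleD`)
and d² = 0 (`tupleD_tupleD`).

The calculus is done for functions on tuples of homogeneous elements, where every sign is an
explicit scalar. Such elements cannot be added across degrees, so the Jacobi identity is imposed on
the values of F instead. Skew symmetry of F plays no role in these three identities. -/

namespace GLSA

/-! ### Cartan calculus for functions on tuples of homogeneous elements -/

section TupleCalculus

variable {Γ k : Type*} [AddCommGroup Γ] [Field k] (ε : CommutationFactor Γ k)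
variable {E W : Type*} [AddCommGroup W] [Module k W] (deg : E → Γ) (br : E → E → E)

/-- The Jacobi identity for `br`, in Leibniz form and inside each argument of `F`. -/
def BracketJacobi {n : ℕ} (F : (Fin n → E) → W) : Prop :=
  ∀ (x : Fin n → E) (j : Fin n) (a b c : E),
    F (Function.update x j (br (br a b) c)) = F (Function.update x j (br a (br b c))) -
      ε (deg a) (deg b) • F (Function.update x j (br b (br a c)))

/-- The Lie derivative along `u` of a function `F` of degree `β` on tuples. -/
def tupleLie {n : ℕ} (act : E → W →ₗ[k] W) (β : Γ) (u : E) (F : (Fin n → E) → W)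
    (y : Fin n → E) : W :=
  act u (F y) - ε (deg u) β • tupleAct ε deg br u F y

/-- The coboundary of a function `F` of degree `β` on tuples, with coefficients in `act`. -/
def tupleD {n : ℕ} (act : E → W →ₗ[k] W) (β : Γ) (F : (Fin n → E) → W) :
    (Fin (n + 1) → E) → W :=
  tupleCobound ε deg br β (fun u y => act u (F y)) F

variable {ε deg br} {act : E → W →ₗ[k] W}

/-- Stability under ι_a is what lets the inductions on the number of arguments pass from F to ι_a F.
-/
theorem BracketJacobi.cons {n : ℕ} {F : (Fin (n + 1) → E) → W} (h : BracketJacobi ε deg br F)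
    (a : E) : BracketJacobi ε deg br (fun r => F (Fin.cons a r)) := by
  intro x j b c d
  have := h (Fin.cons a x) j.succ b c d
  rwa [← Fin.cons_update, ← Fin.cons_update, ← Fin.cons_update] at this

theorem BracketJacobi.cons_bracket {n : ℕ} {F : (Fin (n + 1) → E) → W}
    (h : BracketJacobi ε deg br F) (a b c : E) (r : Fin n → E) :
    F (Fin.cons (br (br a b) c) r) = F (Fin.cons (br a (br b c)) r) -
      ε (deg a) (deg b) • F (Fin.cons (br b (br a c)) r) := by
  simpa [Fin.update_cons_zero] using h (Fin.cons a r) 0 a b c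

/-! ### Linearity of the operators and naturality in the coefficients -/

section Linearity

variable {n : ℕ} (F G : (Fin n → E) → W) (c : k) (u : E) (β : Γ)

theorem tupleAct_sub : tupleAct ε deg br u (fun y => F y - G y) =
    fun y => tupleAct ε deg br u F y - tupleAct ε deg br u G y := by
  funext y
  simp only [tupleAct, smul_sub, Finset.sum_sub_distrib]

theorem tupleAct_smul : tupleAct ε deg br u (fun y => c • F y) =
    fun y => c • tupleAct ε deg br u F y := by
  funext y
  simp only [tupleAct, Finset.smul_sum, smul_comm c]

theorem tupleLie_sub : tupleLie ε deg br act β u (fun y => F y - G y) =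
    fun y => tupleLie ε deg br act β u F y - tupleLie ε deg br act β u G y := by
  funext y
  simp only [tupleLie, tupleAct_sub, map_sub]
  module

theorem tupleLie_smul : tupleLie ε deg br act β u (fun y => c • F y) =
    fun y => c • tupleLie ε deg br act β u F y := by
  funext y
  simp only [tupleLie, tupleAct_smul, map_smul]
  module

theorem tupleD_sub : tupleD ε deg br act β (fun y => F y - G y) =
    fun y => tupleD ε deg br act β F y - tupleD ε deg br act β G y := by
  funext y
  simp only [tupleD, tupleCobound, map_sub, smul_sub, Finset.sum_sub_distrib]
  abel

theorem tupleD_smul : tupleD ε deg br act β (fun y => c • F y) =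
    fun y => c • tupleD ε deg br act β F y := by
  funext y
  simp only [tupleD, tupleCobound, map_smul, Finset.smul_sum, smul_sub, smul_comm c]

theorem tupleAct_map {W' : Type*} [AddCommGroup W'] [Module k W'] (L : W →ₗ[k] W')
    (y : Fin n → E) :
    L (tupleAct ε deg br u F y) = tupleAct ε deg br u (fun y => L (F y)) y := by
  simp only [tupleAct, map_sum, map_smul]

/-- Used with L the evaluation at the last argument, which takes Hom(S, M)-valued cochains to
M-valued ones. The family P is arbitrary since, after evaluation, it is no longer an action applied
to the values of F. -/
theorem tupleCobound_map {W' : Type*} [AddCommGroup W'] [Module k W'] (L : W →ₗ[k] W')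
    (P : E → (Fin n → E) → W) (y : Fin (n + 1) → E) :
    L (tupleCobound ε deg br β P F y) =
      tupleCobound ε deg br β (fun u y => L (P u y)) (fun y => L (F y)) y := by
  simp only [tupleCobound, map_sum, map_smul, map_sub]

end Linearity

/-! ### Interior multiplication, Lie derivative and coboundary -/

/-- The first slot contributes the term with [u, a]. The remaining bracket terms gain the factor
ε(u, a), which is absorbed by regarding ι_a F as a function of degree β + deg a. -/
theorem tupleLie_cons {n : ℕ} (β : Γ) (u a : E) (F : (Fin (n + 1) → E) → W) (r : Fin n → E) :
    tupleLie ε deg br act β u F (Fin.cons a r) =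
      tupleLie ε deg br act (β + deg a) u (fun r => F (Fin.cons a r)) r -
        ε (deg u) β • F (Fin.cons (br u a) r) := by
  simp only [tupleLie, tupleAct_cons, ε.add_right]
  module

theorem tupleD_zero_cons (β : Γ) (a : E) (F : (Fin 0 → E) → W) (r : Fin 0 → E) :
    tupleD ε deg br act β F (Fin.cons a r) =
      ε β (deg a) • tupleLie ε deg br act β a F r := by
  simp [tupleD, tupleCobound_zero, tupleLie, tupleAct]

/-- Cartan's formula. -/
theorem tupleD_succ_cons {n : ℕ} (β : Γ) (a : E) (F : (Fin (n + 1) → E) → W)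
    (r : Fin (n + 1) → E) : tupleD ε deg br act β F (Fin.cons a r) =
      ε β (deg a) • tupleLie ε deg br act β a F r -
        tupleD ε deg br act (β + deg a) (fun r => F (Fin.cons a r)) r := by
  -- `ε.mul_swap` is needed because the action term carries ε(β, a) while the bracket sum carries 1
  -- = ε(β, a) ε(a, β).
  simp only [tupleD, tupleCobound_cons, tupleLie, smul_sub, smul_smul, ε.mul_swap, one_smul]

/-- Without arguments this is the module axiom `hact`. Otherwise contract both sides with c: the
terms without contracted bracket follow by induction, the mixed terms containing ι_[a,c] or ι_[b,c]
cancel in pairs, and the terms where both a and b act on c match by the Jacobi identity. The shifts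
deg b + β and deg a + β are the degrees of the inner Lie derivatives. -/
theorem tupleLie_bracket (hbr : ∀ a b, deg (br a b) = deg a + deg b)
    (hact : ∀ a b w, act (br a b) w = act a (act b w) - ε (deg a) (deg b) • act b (act a w))
    (a b : E) {n : ℕ} (β : Γ) {F : (Fin n → E) → W} (hF : BracketJacobi ε deg br F) :
    tupleLie ε deg br act β (br a b) F = fun y =>
      tupleLie ε deg br act (deg b + β) a (tupleLie ε deg br act β b F) y -
        ε (deg a) (deg b) •
          tupleLie ε deg br act (deg a + β) b (tupleLie ε deg br act β a F) y := by
  -- The degree must vary: ι_c F has degree β + deg c.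
  induction n generalizing β with
  | zero =>
    funext y
    simp [tupleLie, tupleAct, hact]
  | succ n ih =>
    funext y
    obtain ⟨c, r, rfl⟩ : ∃ c r, y = Fin.cons c r := ⟨y 0, Fin.tail y, (Fin.cons_self_tail y).symm⟩
    have h1 := congrFun (ih (β + deg c) (hF.cons c)) r
    have h2 := hF.cons_bracket a b c r
    have e := ε.mul_swap (deg a) (deg b)
    simp only [tupleLie_cons, tupleLie_sub, tupleLie_smul, hbr]
    rw [h1, h2]
    -- Degrees such as deg b + β + deg c and deg b + (β + deg c) index the operators; a common
    -- normal form makes equal terms recognisable before scalars are compared.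
    simp only [ε.add_left, ε.add_right, add_comm, add_left_comm]
    match_scalars <;> grind

/-- Contract with b and apply Cartan's formula to both sides. The commutator of ι_b with L_a leaves
a multiple of dF at [a, b], whose Lie derivative L_[a,b] expands by `tupleLie_bracket`; what remains
is the same identity for ι_b F. No sign appears, d having degree 0. -/
theorem tupleLie_tupleD (hbr : ∀ a b, deg (br a b) = deg a + deg b)
    (hact : ∀ a b w, act (br a b) w = act a (act b w) - ε (deg a) (deg b) • act b (act a w))
    (a : E) {n : ℕ} (β : Γ) {F : (Fin n → E) → W} (hF : BracketJacobi ε deg br F) :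
    tupleLie ε deg br act β a (tupleD ε deg br act β F) =
      tupleD ε deg br act (deg a + β) (tupleLie ε deg br act β a F) := by
  induction n generalizing β with
  | zero =>
    funext y
    obtain ⟨b, r, rfl⟩ : ∃ b r, y = Fin.cons b r := ⟨y 0, Fin.tail y, (Fin.cons_self_tail y).symm⟩
    -- With no arguments left, dF([a, b]) is just ε(β, [a, b]) L_[a,b] F, so no induction hypothesis
    -- enters.
    have h1 := congrFun (tupleLie_bracket hbr hact a b β hF) r
    have e1 := ε.mul_swap (deg a) β
    have e2 := ε.mul_swap (deg a) (deg b)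
    simp only [tupleLie_cons, tupleD_zero_cons, tupleLie_smul, h1, hbr]
    simp only [ε.add_left, ε.add_right, add_comm β (deg b)]
    match_scalars <;> grind
  | succ n ih =>
    funext y
    obtain ⟨b, r, rfl⟩ : ∃ b r, y = Fin.cons b r := ⟨y 0, Fin.tail y, (Fin.cons_self_tail y).symm⟩
    have h1 := congrFun (tupleLie_bracket hbr hact a b β hF) r
    have h2 := congrFun (ih (β + deg b) (hF.cons b)) r
    have e1 := ε.mul_swap (deg a) β
    have e2 := ε.mul_swap (deg a) (deg b)
    simp only [tupleD_succ_cons, tupleLie_cons, tupleLie_smul, tupleLie_sub,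
      tupleD_sub, tupleD_smul, h1, h2, hbr]
    simp only [ε.add_left, ε.add_right, add_comm, add_left_comm]
    match_scalars <;> grind

/-- Applying Cartan's formula twice gives ι_a d d F = ε(β, a)(L_a d - d L_a)F + d d ι_a F. The first
term vanishes by `tupleLie_tupleD`, the second by induction. -/
theorem tupleD_tupleD (hbr : ∀ a b, deg (br a b) = deg a + deg b)
    (hact : ∀ a b w, act (br a b) w = act a (act b w) - ε (deg a) (deg b) • act b (act a w))
    {n : ℕ} (β : Γ) {F : (Fin n → E) → W} (hF : BracketJacobi ε deg br F) :
    tupleD ε deg br act β (tupleD ε deg br act β F) = fun _ => 0 := by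
  induction n generalizing β with
  | zero =>
    funext y
    obtain ⟨a, r, rfl⟩ : ∃ b r, y = Fin.cons b r := ⟨y 0, Fin.tail y, (Fin.cons_self_tail y).symm⟩
    simp only [tupleD_succ_cons, tupleD_zero_cons]
    -- Here ι_a dF is ε(β, a) L_a F alone, so only L_a d = d L_a is used. The last rewrite aligns
    -- the degree β + deg a from Cartan's formula with the degree deg a + β of L_a F.
    rw [tupleD_smul, tupleLie_tupleD hbr hact a β hF, add_comm β (deg a)]
    simp
  | succ n ih =>
    funext y
    obtain ⟨a, r, rfl⟩ : ∃ b r, y = Fin.cons b r := ⟨y 0, Fin.tail y, (Fin.cons_self_tail y).symm⟩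
    simp only [tupleD_succ_cons]
    rw [tupleD_sub, tupleD_smul, ih (β + deg a) (hF.cons a),
      tupleLie_tupleD hbr hact a β hF, add_comm β (deg a)]
    simp

end TupleCalculus

/-! ### Equal degrees and homogeneous tuples -/

section Total

variable {Γ k : Type*} [AddCommGroup Γ] [Field k] {ε : CommutationFactor Γ k}
variable {V W : Type*} [AddCommGroup V] [Module k V] [AddCommGroup W] [Module k W]
variable {𝒱 : Γ → Submodule k V} {𝒲 : Γ → Submodule k W}

theorem mem_cochains_of_eq {n m : ℕ} {β β' : Γ} (h : β = β')
    {f : MultilinearMap k (fun _ : Fin n => V) W} (hf : f ∈ cochains ε 𝒱 𝒲 n m β) :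
    f ∈ cochains ε 𝒱 𝒲 n m β' :=
  h ▸ hf

/-- Degrees such as α + (β + γ) and (α + β) + γ index different types. This moves a summand between
them without changing the underlying multilinear map. -/
theorem lof_cochain_of_eq [DecidableEq Γ] {n m : ℕ} {β β' : Γ} (h : β = β')
    (f : CochainSpace ε 𝒱 𝒲 n m β) :
    DirectSum.lof k Γ (fun β => CochainSpace ε 𝒱 𝒲 n m β) β f =
      DirectSum.lof k Γ (fun β => CochainSpace ε 𝒱 𝒲 n m β) β'
        (.mk f.map (mem_cochains_of_eq h f.map_mem)) := by
  subst h
  rfl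

theorem tuple_ext {Γ k V W : Type*} [DecidableEq Γ] [Field k] [AddCommGroup V] [Module k V]
    [AddCommGroup W] [Module k W] {𝒱 : Γ → Submodule k V} [DirectSum.Decomposition 𝒱] {n : ℕ}
    {f g : MultilinearMap k (fun _ : Fin n => V) W}
    (h : ∀ e : Fin n → (α : Γ) × 𝒱 α, f (fun s => (e s).2) = g (fun s => (e s).2)) : f = g :=
  multilinearMap_ext_of_homogeneous 𝒱 fun α x hx => h fun s => ⟨α s, x s, hx s⟩

end Total

/-! ### The complex of an ε-Lie algebra with coefficients in a module -/

section Lie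

variable {Γ k : Type*} [AddCommGroup Γ] [Field k] {ε : CommutationFactor Γ k}
variable {V W : Type*} [AddCommGroup V] [Module k V] [AddCommGroup W] [Module k W]
variable {𝒱 : Γ → Submodule k V} {𝒲 : Γ → Submodule k W}

/-- Skew symmetry turns [z, x] and [z, [x, y]] in the cyclic Jacobi identity into [x, z] and [[x,
y], z]; multiplying by ε(γ, α)⁻¹ = ε(α, γ) then clears the cyclic factors. -/
theorem EpsLieAlgebra.leibniz (𝔤 : EpsLieAlgebra ε 𝒱) {α β γ : Γ} {x y z : V} (hx : x ∈ 𝒱 α)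
    (hy : y ∈ 𝒱 β) (hz : z ∈ 𝒱 γ) : 𝔤.bracket (𝔤.bracket x y) z =
      𝔤.bracket x (𝔤.bracket y z) - ε α β • 𝔤.bracket y (𝔤.bracket x z) := by
  have h := 𝔤.jacobi hx hy hz
  have h1 := eq_neg_of_add_eq_zero_left (𝔤.skew hz hx)
  have h2 := eq_neg_of_add_eq_zero_left (𝔤.skew hz (𝔤.bracket_mem hx hy))
  have e1 := ε.mul_swap γ α
  have e2 := ε.mul_swap β γ
  rw [h1, h2] at h
  simp only [map_neg, map_smul, ε.add_right] at h
  -- After this scaling the three coefficients are 1, -ε(α, β) and -1.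
  have h3 := congrArg (fun w => ε α γ • w) h
  simp only [smul_add, smul_neg, smul_smul, smul_zero] at h3
  have h4 : ε α γ * ε γ α = 1 := ε.mul_swap α γ
  have h5 : ε α γ * (ε α β * ε γ α) = ε α β := by grind
  have h6 : ε α γ * (ε β γ * (ε γ α * ε γ β)) = 1 := by grind
  rw [h4, h5, h6, one_smul, one_smul] at h3
  rw [← sub_eq_zero, ← neg_eq_zero, ← h3]
  abel

namespace EpsLieModule

variable {𝔤 : EpsLieAlgebra ε 𝒱} (𝔐 : EpsLieModule 𝔤 𝒲)

/-- Multilinearity carries the Leibniz form of the Jacobi identity into any slot of f, so the tuple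
calculus applies to every multilinear map. -/
theorem bracketJacobi {n : ℕ} (f : MultilinearMap k (fun _ : Fin n => V) W) :
    BracketJacobi ε Sigma.fst 𝔤.brHom
      (fun y : Fin n → (α : Γ) × 𝒱 α => f fun s => (y s).2) := by
  intro y j a b c
  simp only [val_update, EpsLieAlgebra.brHom, 𝔤.leibniz a.2.2 b.2.2 c.2.2, f.map_update_sub,
    f.map_update_smul]

theorem act_brHom (a b : (α : Γ) × 𝒱 α) (w : W) : 𝔐.act (𝔤.brHom a b).2 w =
    𝔐.act a.2 (𝔐.act b.2 w) - ε a.1 b.1 • 𝔐.act b.2 (𝔐.act a.2 w) :=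
  𝔐.isModule.act_bracket a.2.2 b.2.2 w

variable [DecidableEq Γ] [DirectSum.Decomposition 𝒱]

/-- Identifies ξ(u) with the Lie derivative: ε(α, β) factors out of each bracket coefficient ε(α, β
+ α_1 + ⋯ + α_{j-1}). -/
theorem actMap_eq_tuple {n : ℕ} (β : Γ) (u : (α : Γ) × 𝒱 α)
    (f : MultilinearMap k (fun _ : Fin n => V) W) (e : Fin n → (α : Γ) × 𝒱 α) :
    𝔐.actMap u.1 β u.2 f (fun s => (e s).2) = tupleLie ε Sigma.fst 𝔤.brHom
      (fun u => 𝔐.act u.2) β u (fun y => f fun s => (y s).2) e := by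
  rw [𝔐.actMap_apply u.1 β u.2 f (fun s => (e s).2.2)]
  simp only [tupleLie, tupleAct, val_update, ε.add_right, Finset.smul_sum, smul_smul]
  rfl

theorem coboundMap_eq_tupleD {n : ℕ} (β : Γ) (f : MultilinearMap k (fun _ : Fin n => V) W)
    (e : Fin (n + 1) → (α : Γ) × 𝒱 α) : 𝔐.coboundMap β f (fun s => (e s).2) =
      tupleD ε Sigma.fst 𝔤.brHom (fun u => 𝔐.act u.2) β (fun y => f fun s => (y s).2) e :=
  𝔐.coboundMap_eq_tuple β f e

theorem coboundMap_coboundMap {n : ℕ} (β : Γ) (f : MultilinearMap k (fun _ : Fin n => V) W) :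
    𝔐.coboundMap β (𝔐.coboundMap β f) = 0 := by
  refine tuple_ext (𝒱 := 𝒱) fun e => ?_
  simp only [coboundMap_eq_tupleD]
  rw [tupleD_tupleD (fun _ _ => rfl) 𝔐.act_brHom β (bracketJacobi f)]
  rfl

theorem actMap_bracket {n : ℕ} (β : Γ) (a b : (α : Γ) × 𝒱 α)
    (f : MultilinearMap k (fun _ : Fin n => V) W) :
    𝔐.actMap (a.1 + b.1) β (𝔤.bracket a.2 b.2) f =
      𝔐.actMap a.1 (b.1 + β) a.2 (𝔐.actMap b.1 β b.2 f) -
        ε a.1 b.1 • 𝔐.actMap b.1 (a.1 + β) b.2 (𝔐.actMap a.1 β a.2 f) := by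
  refine tuple_ext (𝒱 := 𝒱) fun e => ?_
  refine (𝔐.actMap_eq_tuple β (𝔤.brHom a b) f e).trans ?_
  rw [tupleLie_bracket (fun _ _ => rfl) 𝔐.act_brHom a b β (bracketJacobi f)]
  simp only [sub_apply, smul_apply, actMap_eq_tuple]

theorem d_comp_d (n : ℕ) (f : 𝔐.Cochain n) : 𝔐.d (n + 1) (𝔐.d n f) = 0 := by
  have h : 𝔐.d (n + 1) ∘ₗ 𝔐.d n = 0 := by
    refine DirectSum.linearMap_ext k fun β => ?_
    ext1 f
    simp only [LinearMap.comp_apply, d, DirectSum.lmap_lof, LinearMap.zero_apply]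
    rw [show 𝔐.dDeg (n + 1) β (𝔐.dDeg n β f) = 0 from
      CochainSpace.ext (𝔐.coboundMap_coboundMap β f.map), map_zero]
  exact LinearMap.congr_fun h f

theorem cochainAct_isModule (n : ℕ) : 𝔤.IsModule (𝔐.cochainDeg n) (𝔐.cochainAct n) where
  act_mem := by
    rintro α β x _ hx ⟨f, rfl⟩
    exact ⟨_, (totalAct_lof 𝒱 (fun α β => 𝔐.actDeg n α β) ⟨x, hx⟩ f).symm⟩
  act_bracket := by
    intro α β x y hx hy f
    have h : 𝔐.cochainAct n (𝔤.bracket x y) = 𝔐.cochainAct n x ∘ₗ 𝔐.cochainAct n y -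
        ε α β • 𝔐.cochainAct n y ∘ₗ 𝔐.cochainAct n x := by
      refine DirectSum.linearMap_ext k fun γ => ?_
      ext1 f
      have key := fun {α β : Γ} (x : 𝒱 α) (f : CochainSpace ε 𝒱 𝒲 n n β) =>
        totalAct_lof 𝒱 (fun α β => 𝔐.actDeg n α β) x f
      have h1 := key ⟨_, 𝔤.bracket_mem hx hy⟩ f
      have h2 := key ⟨x, hx⟩ (𝔐.actDeg n β γ ⟨y, hy⟩ f)
      have h3 := key ⟨y, hy⟩ (𝔐.actDeg n α γ ⟨x, hx⟩ f)
      rw [← key] at h2 h3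
      simp only [LinearMap.comp_apply, LinearMap.sub_apply, LinearMap.smul_apply]
      refine h1.trans ?_
      refine Eq.trans ?_ (congrArg₂ (fun a b => a - ε α β • b) h2 h3).symm
      -- The two iterated actions land in degrees α + (β + γ) and β + (α + γ); both are moved to the
      -- degree (α + β) + γ of the action of the bracket, where `actMap_bracket` compares the
      -- multilinear maps.
      have e : β + (α + γ) = α + β + γ := by abel
      rw [lof_cochain_of_eq (add_assoc α β γ).symm, lof_cochain_of_eq e, ← map_smul, ← map_sub]
      exact congrArg _ (CochainSpace.ext (𝔐.actMap_bracket γ ⟨α, x, hx⟩ ⟨β, y, hy⟩ f.map))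
    exact LinearMap.congr_fun h f

end EpsLieModule

end Lie

/-! ### Comparison with the left-symmetric complex -/

section LeftSymmetric

namespace Bimodule

variable {Γ k : Type*} [AddCommGroup Γ] [DecidableEq Γ] [Field k] {ε : CommutationFactor Γ k}
variable {S M : Type*} [AddCommGroup S] [Module k S] [AddCommGroup M] [Module k M]
variable {𝒮 : Γ → Submodule k S} [DirectSum.Decomposition 𝒮] {ℳ : Γ → Submodule k M}
variable {A : LeftSymmetricAlgebra ε 𝒮} (B : Bimodule A ℳ)

/-- The last argument is kept apart because it is the one that ψ uncurries; only the first i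
arguments enter the tuple calculus. -/
theorem snoc_ext {Γ k S M : Type*} [DecidableEq Γ] [Field k] [AddCommGroup S] [Module k S]
    [AddCommGroup M] [Module k M] {𝒮 : Γ → Submodule k S} [DirectSum.Decomposition 𝒮] {n : ℕ}
    {f g : MultilinearMap k (fun _ : Fin (n + 1) => S) M}
    (h : ∀ (e : Fin n → (α : Γ) × 𝒮 α) (z : (α : Γ) × 𝒮 α),
      f (Fin.snoc (α := fun _ => S) (fun s => ((e s).2 : S)) z.2) =
        g (Fin.snoc (α := fun _ => S) (fun s => ((e s).2 : S)) z.2)) : f = g := by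
  refine tuple_ext (𝒱 := 𝒮) fun e => ?_
  have := h (fun s => e s.castSucc) (e (Fin.last n))
  have e' : Fin.snoc (α := fun _ => S) (fun s : Fin n => ((e s.castSucc).2 : S))
      ((e (Fin.last n)).2 : S) = fun s => ((e s).2 : S) :=
    Fin.snoc_init_self (α := fun _ => S) (fun s => ((e s).2 : S))
  rwa [e'] at this

/-- Separates ρ(u) into the three terms that will be the action of u on an element of Hom(S, M)
evaluated at z, and the bracket terms on the first i arguments with z held fixed. -/
theorem actMap_eq_tuple {i : ℕ} (β : Γ) (u : (α : Γ) × 𝒮 α)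
    (f : MultilinearMap k (fun _ : Fin (i + 1) => S) M) (e : Fin i → (α : Γ) × 𝒮 α)
    (z : (α : Γ) × 𝒮 α) :
    B.actMap u.1 β u.2 f (Fin.snoc (α := fun _ => S) (fun s => ((e s).2 : S)) z.2) =
      B.left u.2 (f (Fin.snoc (α := fun _ => S) (fun s => ((e s).2 : S)) z.2)) -
      ε u.1 (β + ∑ s, (e s).1) •
        (f (Fin.snoc (α := fun _ => S) (fun s => ((e s).2 : S)) (A.mul u.2 z.2)) -
        B.right (f (Fin.snoc (α := fun _ => S) (fun s => ((e s).2 : S)) u.2)) z.2) -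
      ε u.1 β • tupleAct ε Sigma.fst A.lie.brHom u
        (fun y => f (Fin.snoc (α := fun _ => S) (fun s => ((y s).2 : S)) z.2)) e := by
  have hx : ∀ s, (Fin.snoc (α := fun _ => S) (fun s => ((e s).2 : S)) z.2 :
      Fin (i + 1) → S) s ∈
      𝒮 ((Fin.snoc (α := fun _ => Γ) (fun s => (e s).1) z.1 : Fin (i + 1) → Γ) s) := by
    intro s
    cases s using Fin.lastCases with
    | last => simp only [Fin.snoc_last]; exact z.2.2
    | cast s => simp only [Fin.snoc_castSucc]; exact (e s).2.2
  rw [B.actMap_apply u.1 β u.2 f hx]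
  have s1 : ∀ t : Fin i, (∑ s with s < t.castSucc, (Fin.snoc (α := fun _ => Γ)
      (fun s => (e s).1) z.1 : Fin (i + 1) → Γ) s) = ∑ s with s < t, (e s).1 := by
    intro t
    rw [Finset.sum_filter, Fin.sum_univ_castSucc, Finset.sum_filter]
    simp [Fin.not_lt.2 (Fin.le_last _)]
  have s2 : (∑ s with s < Fin.last i, (Fin.snoc (α := fun _ => Γ)
      (fun s => (e s).1) z.1 : Fin (i + 1) → Γ) s) = ∑ s, (e s).1 := by
    rw [Finset.sum_filter, Fin.sum_univ_castSucc]
    simp [Fin.castSucc_lt_last]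
  simp only [s1, s2, tupleAct, val_update, ε.add_right, Finset.smul_sum, smul_smul,
    Fin.snoc_castSucc, Fin.snoc_last, Fin.update_snoc_last, ← Fin.snoc_update,
    EpsLieAlgebra.brHom]
  module

/-- This makes currying the inverse of ψ. Linear maps on S are determined on homogeneous z, and for
such z both homogeneity and skew symmetry are those of g with last argument z. -/
theorem curryRight_mem {i : ℕ} {β : Γ} {g : MultilinearMap k (fun _ : Fin (i + 1) => S) M}
    (hg : g ∈ cochains ε 𝒮 ℳ (i + 1) i β) :
    g.curryRight ∈ cochains ε 𝒮 (homDeg 𝒮 ℳ) i i β := by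
  intro α x hx
  have hs : ∀ {δ : Γ} {z : S}, z ∈ 𝒮 δ → ∀ s, (Fin.snoc (α := fun _ => S) x z : Fin (i + 1) → S) s ∈
      𝒮 ((Fin.snoc (α := fun _ => Γ) α δ : Fin (i + 1) → Γ) s) := by
    intro δ z hz s
    cases s using Fin.lastCases with
    | last => simpa only [Fin.snoc_last] using hz
    | cast s => simpa only [Fin.snoc_castSucc] using hx s
  constructor
  · intro δ z hz
    have := (hg _ _ (hs hz)).1
    simpa [Fin.sum_univ_castSucc, add_assoc] using this
  · intro p q hpq _
    refine linearMap_ext_of_homogeneous 𝒮 fun δ z hz => ?_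
    exact tupleSkew_of_mem hg ⟨δ, z, hz⟩ (fun s => ⟨α s, x s, hx s⟩) p q hpq

theorem psiDeg_bijective (i : ℕ) (β : Γ) :
    Function.Bijective (psiDeg (ε := ε) (𝒮 := 𝒮) (ℳ := ℳ) i β) := by
  refine Function.bijective_iff_has_inverse.2
    ⟨fun g => .mk g.map.curryRight (curryRight_mem g.map_mem), fun f => ?_, fun g => ?_⟩
  · exact CochainSpace.ext
      (MultilinearMap.curry_uncurryRight (M := fun _ : Fin (i + 1) => S) f.map)
  · exact CochainSpace.ext (MultilinearMap.uncurry_curryRight g.map)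

variable [DirectSum.Decomposition ℳ] [FiniteDimensional k S] [FiniteDimensional k M]

/-- The action on Hom(S, M) has a sign depending on the degree of the map acted upon. Membership
`hf` supplies that degree, β + ∑ α_s, and so produces the coefficient found in d and ρ. -/
theorem homModule_act_tuple {i : ℕ} {β : Γ}
    {f : MultilinearMap k (fun _ : Fin i => S) (S →ₗ[k] M)}
    (hf : f ∈ cochains ε 𝒮 (homDeg 𝒮 ℳ) i i β) (u z : (α : Γ) × 𝒮 α)
    (y : Fin i → (α : Γ) × 𝒮 α) :
    B.homModule.act u.2 (f fun s => (y s).2) z.2 =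
      B.left u.2 (f (fun s => (y s).2) z.2) - ε u.1 (β + ∑ s, (y s).1) •
        (f (fun s => (y s).2) (A.mul u.2 z.2) - B.right (f (fun s => (y s).2) u.2) z.2) := by
  have h := (hf (fun s => (y s).1) (fun s => (y s).2) (fun s => (y s).2.2)).1
  refine (B.homAct_apply u.2.2 h z.2).trans ?_
  module

/-! ### ψ as an isomorphism of complexes and of modules -/

/-- Evaluation at the last argument z is linear, hence passes inside the Lie coboundary. Its bracket
terms are already those of d, and `homModule_act_tuple` turns its action terms into the remaining
ones. -/
theorem uncurryRight_coboundMap {i : ℕ} {β : Γ}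
    {f : MultilinearMap k (fun _ : Fin i => S) (S →ₗ[k] M)}
    (hf : f ∈ cochains ε 𝒮 (homDeg 𝒮 ℳ) i i β) :
    MultilinearMap.uncurryRight (M := fun _ : Fin (i + 1 + 1) => S) (B.homModule.coboundMap β f) =
      B.coboundMap β (MultilinearMap.uncurryRight (M := fun _ : Fin (i + 1) => S) f) := by
  refine snoc_ext (𝒮 := 𝒮) fun e z => ?_
  rw [B.coboundMap_eq_tuple]
  simp only [MultilinearMap.uncurryRight_apply, Fin.init_snoc, Fin.snoc_last]
  rw [B.homModule.coboundMap_eq_tuple]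
  refine (tupleCobound_map _ _ (LinearMap.applyₗ (z.2 : S)) _ _).trans ?_
  simp only [LinearMap.applyₗ_apply_apply, B.homModule_act_tuple hf]

theorem uncurryRight_actMap {i : ℕ} {α β : Γ} {u : S} (hu : u ∈ 𝒮 α)
    {f : MultilinearMap k (fun _ : Fin i => S) (S →ₗ[k] M)}
    (hf : f ∈ cochains ε 𝒮 (homDeg 𝒮 ℳ) i i β) :
    MultilinearMap.uncurryRight (M := fun _ : Fin (i + 1) => S) (B.homModule.actMap α β u f) =
      B.actMap α β u (MultilinearMap.uncurryRight (M := fun _ : Fin (i + 1) => S) f) := by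
  refine snoc_ext (𝒮 := 𝒮) fun e z => ?_
  refine Eq.trans ?_ (B.actMap_eq_tuple β ⟨α, u, hu⟩ _ e z).symm
  simp only [MultilinearMap.uncurryRight_apply, Fin.init_snoc, Fin.snoc_last]
  refine (congrArg (fun g : S →ₗ[k] M => g z.2)
    (B.homModule.actMap_eq_tuple β ⟨α, u, hu⟩ f e)).trans ?_
  have h := tupleAct_map (ε := ε) (deg := Sigma.fst) (br := A.lie.brHom)
    (fun y => f fun s => (y s).2) ⟨α, u, hu⟩ (LinearMap.applyₗ (R := k) (M₂ := M) (z.2 : S)) e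
  -- The first component compares the terms involving the last argument, the second the bracket
  -- terms.
  exact congrArg₂ (fun a b : M => a - ε α β • b) (B.homModule_act_tuple hf ⟨α, u, hu⟩ z e) h

theorem psi_d (i : ℕ) (f : B.homModule.Cochain i) :
    B.psi (i + 1) (B.homModule.d i f) = B.d i (B.psi i f) := by
  have h : B.psi (i + 1) ∘ₗ B.homModule.d i = B.d i ∘ₗ B.psi i := by
    refine DirectSum.linearMap_ext k fun β => ?_
    ext1 f
    simp only [LinearMap.comp_apply, d, psi, EpsLieModule.d, DirectSum.lmap_lof]
    exact congrArg _ (CochainSpace.ext (B.uncurryRight_coboundMap f.map_mem))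
  exact LinearMap.congr_fun h f

theorem psi_cochainAct (i : ℕ) (x : S) (f : B.homModule.Cochain i) :
    B.psi i (B.homModule.cochainAct i x f) = B.cochainAct i x (B.psi i f) := by
  have h : (B.homModule.cochainAct i).compr₂ (B.psi i) = (B.cochainAct i).compl₂ (B.psi i) := by
    refine linearMap_ext_of_homogeneous 𝒮 fun α x hx => ?_
    refine DirectSum.linearMap_ext k fun β => ?_
    ext1 f
    have h1 := totalAct_lof 𝒮 (fun α β => B.homModule.actDeg i α β) ⟨x, hx⟩ f
    have h2 := totalAct_lof 𝒮 (fun α β => B.actDeg i α β) ⟨x, hx⟩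
      (psiDeg (ε := ε) (𝒮 := 𝒮) (ℳ := ℳ) i β f)
    simp only [LinearMap.comp_apply, LinearMap.compr₂_apply, LinearMap.compl₂_apply]
    refine (congrArg (B.psi i) h1).trans ?_
    simp only [psi, DirectSum.lmap_lof]
    refine Eq.trans ?_ h2.symm
    exact congrArg _ (CochainSpace.ext (B.uncurryRight_actMap hx f.map_mem))
  exact LinearMap.congr_fun (LinearMap.congr_fun h x) f

theorem psi_bijective (i : ℕ) : Function.Bijective (B.psi i) :=
  ⟨(DirectSum.lmap_injective _).2 fun β => (psiDeg_bijective i β).1,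
    (DirectSum.lmap_surjective _).2 fun β => (psiDeg_bijective i β).2⟩

theorem map_psi_cochainDeg (i : ℕ) (γ : Γ) :
    (B.homModule.cochainDeg i γ).map (B.psi i) = B.cochainDeg i γ := by
  have h : B.psi i ∘ₗ DirectSum.lof k Γ _ γ =
      DirectSum.lof k Γ _ γ ∘ₗ psiDeg (ε := ε) (𝒮 := 𝒮) (ℳ := ℳ) i γ := by
    ext1 f
    simp only [LinearMap.comp_apply, psi, DirectSum.lmap_lof]
  rw [cochainDeg, EpsLieModule.cochainDeg, totalDeg, totalDeg, ← LinearMap.range_comp, h,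
    LinearMap.range_comp, LinearMap.range_eq_top.2 (psiDeg_bijective i γ).2, Submodule.map_top]

/-- The module law is transported from the ε-Lie side: every cochain is ψ(f), and ψ intertwines the
actions. -/
theorem cochainAct_isModule (i : ℕ) : A.lie.IsModule (B.cochainDeg i) (B.cochainAct i) where
  act_mem := by
    rintro α β x _ hx ⟨f, rfl⟩
    exact ⟨_, (totalAct_lof 𝒮 (fun α β => B.actDeg i α β) ⟨x, hx⟩ f).symm⟩
  act_bracket := by
    intro α β x y hx hy g
    obtain ⟨f, rfl⟩ := (B.psi_bijective i).2 g
    simp only [← psi_cochainAct, (B.homModule.cochainAct_isModule i).act_bracket hx hy f,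
      map_sub, map_smul]

/-- Writing g = ψ(f) gives d d ψ(f) = ψ(𝔡 𝔡 f) = 0. -/
theorem d_comp_d (i : ℕ) (g : B.Cochain i) : B.d (i + 1) (B.d i g) = 0 := by
  obtain ⟨f, rfl⟩ := (B.psi_bijective i).2 g
  rw [← psi_d, ← psi_d, EpsLieModule.d_comp_d, map_zero]

/-! ### Cocycles, coboundaries and cohomology -/

theorem psi_mem_cocycles_iff (i : ℕ) (f : B.homModule.Cochain i) :
    B.psi i f ∈ B.cocycles i ↔ f ∈ B.homModule.cocycles i := by
  rw [cocycles, EpsLieModule.cocycles, LinearMap.mem_ker, LinearMap.mem_ker, ← psi_d]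
  exact map_eq_zero_iff _ (B.psi_bijective (i + 1)).1

/-- Surjectivity of ψ one degree below and injectivity in the present degree suffice. The index
starts at i + 1 because `coboundaries 0` is zero on the Lie side, but on the other side it is the
image of C⁰(S, M). -/
theorem psi_mem_coboundaries_iff (i : ℕ) (f : B.homModule.Cochain (i + 1)) :
    B.psi (i + 1) f ∈ B.coboundaries (i + 1) ↔ f ∈ B.homModule.coboundaries (i + 1) := by
  constructor
  · rintro ⟨g, hg⟩
    obtain ⟨f', rfl⟩ := (B.psi_bijective i).2 g
    rw [← psi_d] at hg
    exact ⟨f', (B.psi_bijective (i + 1)).1 hg⟩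
  · rintro ⟨f', rfl⟩
    exact ⟨B.psi i f', (B.psi_d i f').symm⟩

/-- The isomorphism of spaces of cocycles induced by `ψ`. -/
noncomputable def psiCocycles (i : ℕ) : B.homModule.cocycles i ≃ₗ[k] B.cocycles i :=
  LinearEquiv.ofBijective
    ((B.psi i).restrict fun f hf => (B.psi_mem_cocycles_iff i f).2 hf)
    ⟨fun _ _ h => Subtype.ext ((B.psi_bijective i).1 (congrArg Subtype.val h)), fun g => by
      obtain ⟨f, hf⟩ := (B.psi_bijective i).2 g
      exact ⟨⟨f, (B.psi_mem_cocycles_iff i f).1 (hf ▸ g.2)⟩, Subtype.ext hf⟩⟩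

/-- The isomorphism in cohomology induced by `ψ`, in positive degrees. -/
noncomputable def psiCohomology (i : ℕ) :
    B.homModule.Cohomology (i + 1) ≃ₗ[k] B.Cohomology (i + 1) :=
  Submodule.Quotient.equiv _ _ (B.psiCocycles (i + 1)) (by
    ext g
    -- With g the image of a cocycle f, the equality of submodules becomes the statement that f is a
    -- coboundary exactly when ψ(f) is.
    obtain ⟨f, rfl⟩ := (B.psiCocycles (i + 1)).surjective g
    rw [← LinearEquiv.coe_coe, Submodule.mem_map_equiv, LinearEquiv.coe_coe,
      LinearEquiv.symm_apply_apply]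
    exact (B.psi_mem_coboundaries_iff i f).symm)

end Bimodule

end LeftSymmetric

end GLSA

/-! ### The main theorem -/

theorem theorem4p1 {Γ k : Type*} [AddCommGroup Γ] [DecidableEq Γ] [Field k] [CharZero k]
    (ε : GLSA.CommutationFactor Γ k)
    {S M : Type*} [AddCommGroup S] [Module k S] [FiniteDimensional k S]
    [AddCommGroup M] [Module k M] [FiniteDimensional k M]
    (𝒮 : Γ → Submodule k S) [DirectSum.Decomposition 𝒮]
    (ℳ : Γ → Submodule k M) [DirectSum.Decomposition ℳ]
    (A : GLSA.LeftSymmetricAlgebra ε 𝒮) (B : GLSA.Bimodule A ℳ) :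
    -- `ψ` is an isomorphism of `𝔤_S`-modules
    (∀ i : ℕ,
      A.lie.IsModule (B.homModule.cochainDeg i) (B.homModule.cochainAct i) ∧
      A.lie.IsModule (B.cochainDeg i) (B.cochainAct i) ∧
      Function.Bijective (B.psi i) ∧
      (∀ γ : Γ, (B.homModule.cochainDeg i γ).map (B.psi i) = B.cochainDeg i γ) ∧
      ∀ (x : S) (f : B.homModule.Cochain i),
        B.psi i (B.homModule.cochainAct i x f) = B.cochainAct i x (B.psi i f)) ∧
    -- `ψ` is an isomorphism of cochain complexes
    (∀ i : ℕ,
      (∀ f : B.homModule.Cochain i, B.homModule.d (i + 1) (B.homModule.d i f) = 0) ∧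
      (∀ g : B.Cochain i, B.d (i + 1) (B.d i g) = 0) ∧
      ∀ f : B.homModule.Cochain i, B.psi (i + 1) (B.homModule.d i f) = B.d i (B.psi i f)) ∧
    -- `ψ` induces isomorphisms `H^i_Lie(𝔤_S, C¹(S, M)) ≅ H^{i+1}(S, M)` for `i > 0`
    (∀ i : ℕ, 0 < i → ∃ Φ : B.homModule.Cohomology i ≃ₗ[k] B.Cohomology i,
      ∀ z : B.homModule.cocycles i, ∃ hz : B.psi i z ∈ B.cocycles i,
        Φ (Submodule.Quotient.mk z) = Submodule.Quotient.mk ⟨B.psi i z, hz⟩) := by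
  refine ⟨fun i => ⟨B.homModule.cochainAct_isModule i, B.cochainAct_isModule i,
    B.psi_bijective i, B.map_psi_cochainDeg i, B.psi_cochainAct i⟩,
    fun i => ⟨B.homModule.d_comp_d i, B.d_comp_d i, B.psi_d i⟩, fun i hi => ?_⟩
  -- `B.Cohomology i` denotes H^{i+1}(S, M), so the index shift of the isomorphism is built into the
  -- notation. Positivity of i puts both coboundary spaces in the range where they are images of 𝔡
  -- and d.
  obtain ⟨i, rfl⟩ := Nat.exists_eq_succ_of_ne_zero hi.ne'
  exact ⟨B.psiCohomology i, fun z => ⟨(B.psi_mem_cocycles_iff _ _).2 z.2, rfl⟩⟩
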